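/- Conventions. Let $\lambda$ be a partition with $d$ (nonzero) parts and let $\mu$ be a partition with $[\mu]\subseteq[\lambda]$; write $[\lambda/\mu]=[\lambda]\setminus[\mu]$, and let $c(i,j)=j-i$ be the content of a cell. $\mathrm{OOT}(\lambda/\mu)$ denotes the number of semistandard Young tableaux $T$ of shape $\mu$ with entries in $\{1,\dots,d\}$ such that $c(u)<\lambda_{d+1-T(u)}$ for all $u\in[\mu]$. If a set $S$ of cells is the diagram of a skew shape, $S=[\alpha/\beta]$, put $\mathrm{OOT}(S)=\mathrm{OOT}(\alpha/\beta)$. Let $\theta$ be the border strip of $\lambda$, i.e. the set of cells $(i,j)\in[\lambda]$ with $(i+1,j+1)\notin[\lambda]$, restricted to the contents between the minimum and the maximum content in $[\lambda/\mu]$. The Lascoux--Pragacz decomposition of $\lambda/\mu$ is the set of (edge-)connected components of the intersections of $[\lambda/\mu]$ with the translates of $\theta$ by $(k,k)$, $k\in\mathbb Z$; list it in any order as $(\theta_1,\dots,\theta_n)$, and let the contents of $\theta_i$ range from $m_i$ to $n_i$. Let $\theta_i\#\theta_j$ be the set of cells of $\theta$ (so placed on the border strip of $\lambda$) with contents from $m_i$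 to $n_j$ if $m_i\le n_j$; it is undefined if $n_j<m_i$, and then $\mathrm{OOT}(\theta_i\#\theta_j)=0$. Theorem. If $(\theta_1,\dots,\theta_n)$ is the Lascoux--Pragacz decomposition of a skew shape $\lambda/\mu$, then for all $i,j$ with $m_i\le n_j$ the set $\theta_i\#\theta_j$ is the diagram $[\lambda/\nu]$ of a skew shape for some partition $\nu$ with $[\nu]\subseteq[\lambda]$, the number $\mathrm{OOT}(\theta_i\#\theta_j)$ is well defined (it does not depend on the skew shape $\alpha/\beta$ with $[\alpha/\beta]=\theta_i\#\theta_j$), and $$\mathrm{OOT}(\lambda/\mu)=\det\bigl[\mathrm{OOT}(\theta_i\#\theta_j)\bigr]_{i,j=1}^n .$$ -/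

import Mathlib

namespace OkounkovOlshanski

/-- The content `column - row` of a cell. Cells are indexed from `0`, as in `YoungDiagram`; the
content is the same as with indexing from `1`. -/
def content (c : ℕ × ℕ) : ℤ := (c.2 : ℤ) - (c.1 : ℤ)

/-- The diagram `[α/β]` of a skew shape. -/
def skewCells (α β : YoungDiagram) : Set (ℕ × ℕ) := {c | c ∈ α ∧ c ∉ β}

/-- The Okounkov--Olshanski tableaux of `α/β`, where `α` has `d = α.colLen 0` (nonzero) parts:
semistandard tableaux of shape `β` with entries in `{1, …, d}` such that every cell `u` satisfies
`c(u) < α_{d + 1 - T(u)}`. Here `α_k = α.rowLen (k - 1)`. Entries of Mathlib's semistandard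
tableaux may be `0`, so positivity is imposed. -/
def ooTableaux (α β : YoungDiagram) : Set (SemistandardYoungTableau β) :=
  {T | ∀ i j : ℕ, (i, j) ∈ β →
    1 ≤ T i j ∧ T i j ≤ α.colLen 0 ∧ content (i, j) < (α.rowLen (α.colLen 0 - T i j) : ℤ)}

/-- `OOT(α/β)`, the number of Okounkov--Olshanski tableaux. -/
noncomputable def oot (α β : YoungDiagram) : ℕ := (ooTableaux α β).ncard

open Classical in
/-- `OOT` of a set of cells `S` that is the diagram of a skew shape: the value `OOT(α/β)` for a
skew shape `α/β` with `[α/β] = S` (and `0` if there is none). -/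
noncomputable def ootOfCells (S : Set (ℕ × ℕ)) : ℕ :=
  if h : ∃ p : YoungDiagram × YoungDiagram, p.2 ≤ p.1 ∧ skewCells p.1 p.2 = S then
    oot h.choose.1 h.choose.2
  else 0

/-- The border strip (outer strip) of `lam`: the cells of `lam` whose south-east diagonal
neighbour is not in `lam`. -/
def borderStrip (lam : YoungDiagram) : Set (ℕ × ℕ) :=
  {c | c ∈ lam ∧ (c.1 + 1, c.2 + 1) ∉ lam}

/-- The part of the border strip of `lam` whose contents lie between the minimum and the maximum
content of the cells of `[lam/mu]`. -/
def cuttingStrip (lam mu : YoungDiagram) : Set (ℕ × ℕ) :=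
  {c | c ∈ borderStrip lam ∧
    ∃ u ∈ skewCells lam mu, ∃ v ∈ skewCells lam mu,
      content u ≤ content c ∧ content c ≤ content v}

/-- The intersection of `[lam/mu]` with the cutting strip translated by `(k, k)`. -/
def shiftedIntersection (lam mu : YoungDiagram) (k : ℤ) : Set (ℕ × ℕ) :=
  {c | c ∈ skewCells lam mu ∧
    ∃ u ∈ cuttingStrip lam mu, (c.1 : ℤ) = (u.1 : ℤ) + k ∧ (c.2 : ℤ) = (u.2 : ℤ) + k}

/-- Two cells share an edge. -/
def CellAdj (u v : ℕ × ℕ) : Prop :=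
  (u.1 = v.1 ∧ (u.2 + 1 = v.2 ∨ v.2 + 1 = u.2)) ∨ (u.2 = v.2 ∧ (u.1 + 1 = v.1 ∨ v.1 + 1 = u.1))

/-- The (edge-)connected component of the cell `c` in the set of cells `S`. -/
def component (S : Set (ℕ × ℕ)) (c : ℕ × ℕ) : Set (ℕ × ℕ) :=
  {v | Relation.ReflTransGen (fun x y => x ∈ S ∧ y ∈ S ∧ CellAdj x y) c v}

/-- The set of strips of the Lascoux--Pragacz decomposition of `lam/mu`: the connected components
of the intersections of `[lam/mu]` with the diagonal translates of the cutting strip. -/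
def lascouxPragaczStrips (lam mu : YoungDiagram) : Set (Set (ℕ × ℕ)) :=
  {C | ∃ k : ℤ, ∃ c ∈ shiftedIntersection lam mu k, C = component (shiftedIntersection lam mu k) c}

/-- `θ = (θ_1, …, θ_n)` lists, without repetition and in any order, the strips of the
Lascoux--Pragacz decomposition of `lam/mu`. -/
def IsLascouxPragacz (lam mu : YoungDiagram) {n : ℕ} (θ : Fin n → Set (ℕ × ℕ)) : Prop :=
  Function.Injective θ ∧ Set.range θ = lascouxPragaczStrips lam mu

/-- The substrip of the cutting strip, placed on the border strip of `lam`, with contents from `a`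
to `b`. -/
def substrip (lam mu : YoungDiagram) (a b : ℤ) : Set (ℕ × ℕ) :=
  {c | c ∈ cuttingStrip lam mu ∧ a ≤ content c ∧ content c ≤ b}

/-- `OOT` of the substrip with contents from `a` to `b`; it is `0` if `b < a`, when the substrip
is undefined. -/
noncomputable def ootSubstrip (lam mu : YoungDiagram) (a b : ℤ) : ℤ :=
  if a ≤ b then (ootOfCells (substrip lam mu a b) : ℤ) else 0

end OkounkovOlshanski

/-! Encode a shape by its beads, the contents of the last cells of its rows. With `a` and `b` the
beads of the outer and inner shapes, the number of tableaux is the flagged Jacobi-Trudi determinant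
of the values h_{a i - b j} in i + 1 variables at 1 (`oot_eq_det`). Deleting the largest entry gives
a recursion over interlacing shapes, and column differences give the same recursion for the
determinant.

For fixed `a` these determinants are maximal minors of one matrix with columns indexed by integers.
The minor on the columns `a` is unitriangular, so by Cramer's rule a minor obtained by replacing n
of these columns is the n × n determinant of minors with a single replacement
(`det_flagMatrix_eq_det_replaceBead`). Replacing a bead by a smaller unoccupied position removes a
border strip, up to a sign (`det_replaceBead`).

The strips of the decomposition tell which bead replaces which: the right ends are the beads of
`lam` that are not beads of `mu`, and each left end minus one is a bead of `mu` that is not one of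
`lam`. Thus the single replacements are exactly the θ_i # θ_j. Strips never cross
(`IsStripInterval.not_cross`), and this makes the sorting sign cancel against the signs of the
entries. -/

namespace OkounkovOlshanski

/-! ### Beads and the recursion for the flagged determinant -/

/-- The complete homogeneous symmetric polynomial `h_n` in `i + 1` variables at `1`. -/
def flagH (i : ℕ) (n : ℤ) : ℤ := if n < 0 then 0 else ((n.toNat + i).choose i : ℤ)

lemma flagH_of_neg {i : ℕ} {n : ℤ} (h : n < 0) : flagH i n = 0 := by simp [flagH, h]

lemma flagH_zero_right (i : ℕ) : flagH i 0 = 1 := by simp [flagH]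

lemma flagH_zero_left {n : ℤ} (h : 0 ≤ n) : flagH 0 n = 1 := by simp [flagH, h]

lemma flagH_succ (i : ℕ) (n : ℤ) : flagH (i + 1) n = flagH (i + 1) (n - 1) + flagH i n := by
  rcases lt_trichotomy n 0 with h | rfl | h
  · rw [flagH_of_neg h, flagH_of_neg h, flagH_of_neg (by omega)]; rfl
  · rw [flagH_zero_right, flagH_zero_right, flagH_of_neg (by omega)]; rfl
  · obtain ⟨k, rfl⟩ : ∃ k : ℕ, n = k + 1 := ⟨(n - 1).toNat, by omega⟩
    have h1 : ¬ ((k : ℤ) + 1 < 0) := by omega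
    have h2 : ¬ ((k : ℤ) < 0) := by omega
    have h3 : ((k : ℤ) + 1).toNat = k + 1 := by omega
    simp only [flagH, h1, h2, h3, if_false, add_sub_cancel_right, Int.toNat_natCast]
    rw [show k + 1 + (i + 1) = (k + 1 + i) + 1 by ring, Nat.choose_succ_succ,
      show k + (i + 1) = k + 1 + i by ring]
    push_cast
    ring

/-- Telescoping of `flagH_succ`: a difference of adjacent columns becomes a sum over the possible
lengths of a truncated row. -/
lemma sum_Icc_flagH (i : ℕ) (x : ℤ) {m n : ℕ} (h : m ≤ n) :
    ∑ k ∈ Finset.Icc m n, flagH i (x - k) = flagH (i + 1) (x - m) - flagH (i + 1) (x - n - 1) := by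
  induction n, h using Nat.le_induction with
  | base => rw [Finset.Icc_self, Finset.sum_singleton, flagH_succ i (x - m)]; ring
  | succ n h ih =>
    have := flagH_succ i (x - (n + 1 : ℕ))
    rw [Finset.sum_Icc_succ_top (by omega), ih]
    rw [show x - (n : ℤ) - 1 = x - (n + 1 : ℕ) by push_cast; ring]
    linarith

/-- The position of the `i`-th bead of the shape with row lengths `f`: the content of the last cell
of row `i`. -/
def bead (f : ℕ → ℕ) (i : ℕ) : ℤ := (f i : ℤ) - i - 1

lemma bead_strictAnti {f : ℕ → ℕ} (hf : Antitone f) : StrictAnti (bead f) := by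
  intro i j h
  have := hf h.le
  simp only [bead]
  omega

/-- The Jacobi--Trudi matrix for skew tableaux whose entries in row `i` are at most `i + 1`. -/
def flagMatrix (d : ℕ) (a : ℕ → ℤ) (b : Fin d → ℤ) : Matrix (Fin d) (Fin d) ℤ :=
  Matrix.of fun i j => flagH i (a i - b j)

/-- Extend a tuple by zero. -/
def extendZero {d : ℕ} (κ : Fin d → ℕ) (i : ℕ) : ℕ := if h : i < d then κ ⟨i, h⟩ else 0

/-- The first row uses one variable, so it is constantly 1. Subtracting adjacent columns clears it
up to its first entry. The remaining entries are sums over interlacing row lengths, which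
multilinearity expands. -/
lemma det_flagMatrix_succ (d : ℕ) (L f : ℕ → ℕ) (hf : Antitone f) (h0 : f 0 ≤ L 0) :
    (flagMatrix (d + 1) (bead L) (fun j => bead f j)).det =
      ∑ κ ∈ Fintype.piFinset (fun j : Fin d => Finset.Icc (f (j + 1)) (f j)),
        (flagMatrix d (bead (fun i => L (i + 1))) (fun j => bead (extendZero κ) j)).det := by
  set A := flagMatrix (d + 1) (bead L) (fun j => bead f j) with hA
  let B : Matrix (Fin (d + 1)) (Fin (d + 1)) ℤ := Matrix.of fun i =>
    Fin.cons (A i 0) fun j => A i j.succ - A i j.castSucc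
  have hdet : A.det = B.det := by
    apply Matrix.det_eq_of_forall_col_eq_smul_add_pred (fun _ => 1)
    · intro i; simp [B]
    · intro i j; simp [B]
  -- Here `h0` is needed: it makes all indices in row 0 nonnegative.
  have hone : ∀ j, A 0 j = 1 := by
    intro j
    apply flagH_zero_left
    have : f j ≤ f 0 := hf (Nat.zero_le _)
    simp only [bead, Fin.val_zero]
    omega
  have hB : ∀ j : Fin d, B 0 j.succ = 0 := by
    intro j; simp [B, hone]
  have hB0 : B 0 0 = 1 := by simp [B, hone]
  rw [hdet, Matrix.det_succ_row_zero, Fin.sum_univ_succ]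
  simp only [hB, hB0, mul_zero, zero_mul, Finset.sum_const_zero, add_zero, Fin.val_zero, pow_zero,
    one_mul]
  have hsub : (B.submatrix Fin.succ (Fin.succAbove 0)).transpose = fun j : Fin d =>
      ∑ k ∈ Finset.Icc (f (j + 1)) (f j),
        fun i : Fin d => flagH i ((L (i + 1) : ℤ) - i + j - k) := by
    funext j i
    rw [Finset.sum_apply, sum_Icc_flagH _ _ (hf (Nat.le_succ j))]
    simp only [Matrix.transpose_apply, Matrix.submatrix_apply, B, A, flagMatrix, Matrix.of_apply,
      Fin.zero_succAbove, Fin.cons_succ, bead, Fin.val_succ, Fin.val_castSucc]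
    congr 2 <;> push_cast <;> ring
  rw [← Matrix.det_transpose, hsub]
  have := (Matrix.detRowAlternating (n := Fin d) (R := ℤ)).toMultilinearMap.map_sum_finset
    (fun (j : Fin d) (k : ℕ) => fun i : Fin d => flagH i ((L (i + 1) : ℤ) - i + j - k))
    (fun j : Fin d => Finset.Icc (f (j + 1)) (f j))
  refine Eq.trans this ?_
  refine Finset.sum_congr rfl fun κ _ => ?_
  rw [← Matrix.det_transpose]
  change Matrix.det _ = Matrix.det _
  congr 1
  funext j i
  simp only [Matrix.transpose_apply, flagMatrix, Matrix.of_apply, bead, extendZero, Fin.is_lt,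
    dif_pos, Fin.eta]
  congr 1
  ring

lemma det_flagMatrix_eq_zero (d : ℕ) (L f : ℕ → ℕ) (hL : Antitone L) (h0 : L 0 < f 0) :
    (flagMatrix (d + 1) (bead L) (fun j => bead f j)).det = 0 := by
  apply Matrix.det_eq_zero_of_column_eq_zero 0
  intro i
  apply flagH_of_neg
  have : L i ≤ L 0 := hL (Nat.zero_le _)
  simp only [bead, Fin.val_zero]
  omega

/-! ### Tableaux and the removal of the largest entry -/

/-- Tableaux of the shape with row lengths `f`, with entries in `{1, …, d}` and contents bounded
through `L` as in Okounkov--Olshanski tableaux. -/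
def tableauxFun (d : ℕ) (L f : ℕ → ℕ) : Set (ℕ → ℕ → ℕ) :=
  {T | (∀ i j, j < f i → 1 ≤ T i j ∧ T i j ≤ d ∧ (j : ℤ) - i < L (d - T i j)) ∧
    (∀ i j, f i ≤ j → T i j = 0) ∧
    (∀ i j₁ j₂, j₁ < j₂ → j₂ < f i → T i j₁ ≤ T i j₂) ∧
    (∀ i₁ i₂ j, i₁ < i₂ → j < f i₂ → T i₁ j < T i₂ j)}

lemma lt_entry_of_mem_tableauxFun {d : ℕ} {L f : ℕ → ℕ} (hf : Antitone f) {T : ℕ → ℕ → ℕ}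
    (hT : T ∈ tableauxFun d L f) {i j : ℕ} (hj : j < f i) : i < T i j := by
  induction i with
  | zero => exact (hT.1 0 j hj).1
  | succ i ih =>
    have h1 := ih (hj.trans_le (hf (Nat.le_succ i)))
    have h2 := hT.2.2.2 i (i + 1) j (Nat.lt_succ_self i) hj
    omega

lemma tableauxFun_eq_empty {d : ℕ} {L f : ℕ → ℕ} (hL : Antitone L) (h0 : L 0 < f 0) :
    tableauxFun d L f = ∅ := by
  ext T
  simp only [Set.mem_empty_iff_false, iff_false]
  intro hT
  have h := (hT.1 0 (f 0 - 1) (by omega)).2.2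
  have h' : L (d - T 0 (f 0 - 1)) ≤ L 0 := hL (Nat.zero_le _)
  omega

/-- The row lengths of the subtableau of entries at most `d`. -/
def truncLen (d : ℕ) (f : ℕ → ℕ) (T : ℕ → ℕ → ℕ) (i : ℕ) : ℕ :=
  ((Finset.range (f i)).filter fun j => T i j ≤ d).card

lemma truncLen_le (d : ℕ) (f : ℕ → ℕ) (T : ℕ → ℕ → ℕ) (i : ℕ) : truncLen d f T i ≤ f i :=
  (Finset.card_filter_le _ _).trans (Finset.card_range _).le

lemma lt_truncLen_iff {d : ℕ} {f : ℕ → ℕ} {T : ℕ → ℕ → ℕ} {i : ℕ}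
    (hrow : ∀ j₁ j₂, j₁ < j₂ → j₂ < f i → T i j₁ ≤ T i j₂) (j : ℕ) :
    j < truncLen d f T i ↔ j < f i ∧ T i j ≤ d := by
  have mono : ∀ j₁ j₂, j₁ ≤ j₂ → j₂ < f i → T i j₁ ≤ T i j₂ := fun j₁ j₂ h h' => by
    rcases h.lt_or_eq with h | rfl
    · exact hrow _ _ h h'
    · exact le_rfl
  constructor
  · intro hj
    by_contra hcon
    have : (Finset.range (f i)).filter (fun j => T i j ≤ d) ⊆ Finset.range j := by
      intro k hk
      simp only [Finset.mem_filter, Finset.mem_range] at hk ⊢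
      by_contra hkj
      push Not at hkj
      exact hcon ⟨hkj.trans_lt hk.1, (mono _ _ hkj hk.1).trans hk.2⟩
    have := Finset.card_le_card this
    rw [Finset.card_range] at this
    exact absurd hj (not_lt.2 this)
  · rintro ⟨h1, h2⟩
    have : Finset.range (j + 1) ⊆ (Finset.range (f i)).filter (fun j => T i j ≤ d) := by
      intro k hk
      simp only [Finset.mem_filter, Finset.mem_range] at hk ⊢
      exact ⟨by omega, (mono k j (by omega) h1).trans h2⟩
    have := Finset.card_le_card this
    rw [Finset.card_range] at this
    exact this

/-- Delete the entries greater than `d`. -/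
def truncFun (d : ℕ) (T : ℕ → ℕ → ℕ) (i j : ℕ) : ℕ := if T i j ≤ d then T i j else 0

/-- Fill the cells of shape `f` outside of the shape `κ` with the entry `e`. -/
def fillFun (e : ℕ) (f κ : ℕ → ℕ) (T : ℕ → ℕ → ℕ) (i j : ℕ) : ℕ :=
  if j < κ i then T i j else if j < f i then e else 0

/-- The entries d + 1 form a horizontal strip: a cell with another cell below it has an entry at
most d by column strictness. -/
lemma truncLen_interlace {d : ℕ} {L f : ℕ → ℕ} (hf : Antitone f) {T : ℕ → ℕ → ℕ}
    (hT : T ∈ tableauxFun (d + 1) L f) (i : ℕ) : f (i + 1) ≤ truncLen d f T i := by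
  by_contra hlt
  push Not at hlt
  set j := truncLen d f T i with hj
  have h1 : j < f i := hlt.trans_le (hf (Nat.le_succ i))
  have h2 := hT.2.2.2 i (i + 1) j (Nat.lt_succ_self i) hlt
  have h3 := (hT.1 (i + 1) j hlt).2.1
  have := (lt_truncLen_iff (hT.2.2.1 i) j (d := d)).2 ⟨h1, by omega⟩
  omega

lemma truncLen_eq_zero {d : ℕ} {L f : ℕ → ℕ} (hf : Antitone f) {T : ℕ → ℕ → ℕ}
    (hT : T ∈ tableauxFun (d + 1) L f) {i : ℕ} (hi : d ≤ i) : truncLen d f T i = 0 := by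
  by_contra hne
  have h := (lt_truncLen_iff (hT.2.2.1 i) 0 (d := d)).1 (by omega)
  have := lt_entry_of_mem_tableauxFun hf hT h.1
  omega

lemma truncFun_mem {d : ℕ} {L f : ℕ → ℕ} {T : ℕ → ℕ → ℕ}
    (hT : T ∈ tableauxFun (d + 1) L f) :
    truncFun d T ∈ tableauxFun d (fun i => L (i + 1)) (truncLen d f T) := by
  have key := fun i j => lt_truncLen_iff (hT.2.2.1 i) j (d := d)
  refine ⟨fun i j hj => ?_, fun i j hj => ?_, fun i j₁ j₂ h hj => ?_, fun i₁ i₂ j h hj => ?_⟩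
  · obtain ⟨h1, h2⟩ := (key i j).1 hj
    have h3 := hT.1 i j h1
    simp only [truncFun, h2, if_true]
    refine ⟨h3.1, trivial, ?_⟩
    -- The bound is indexed from the largest entry downwards, so deleting that entry drops the first
    -- term of `L`.
    rw [show d - T i j + 1 = d + 1 - T i j by omega]
    exact h3.2.2
  · rcases lt_or_ge j (f i) with h | h
    · have : ¬ T i j ≤ d := fun h' => absurd ((key i j).2 ⟨h, h'⟩) (not_lt.2 hj)
      simp [truncFun, this]
    · simp [truncFun, hT.2.1 i j h]
  · obtain ⟨h1, h2⟩ := (key i j₂).1 hj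
    have h3 := hT.2.2.1 i j₁ j₂ h h1
    simp only [truncFun, h2, h3.trans h2, if_true, h3]
  · obtain ⟨h1, h2⟩ := (key i₂ j).1 hj
    have h3 := hT.2.2.2 i₁ i₂ j h h1
    simp only [truncFun, h2, h3.le.trans h2, if_true, h3]

lemma fillFun_mem {d : ℕ} {L f κ : ℕ → ℕ} (hf : Antitone f) (h0 : f 0 ≤ L 0)
    (hκ : ∀ i, κ i ≤ f i) (hκ' : ∀ i, f (i + 1) ≤ κ i) {T : ℕ → ℕ → ℕ}
    (hT : T ∈ tableauxFun d (fun i => L (i + 1)) κ) :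
    fillFun (d + 1) f κ T ∈ tableauxFun (d + 1) L f := by
  have hanti : ∀ i₁ i₂, i₁ < i₂ → f i₂ ≤ κ i₁ := fun i₁ i₂ h => (hf h).trans (hκ' i₁)
  refine ⟨fun i j hj => ?_, fun i j hj => ?_, fun i j₁ j₂ h hj => ?_, fun i₁ i₂ j h hj => ?_⟩
  · by_cases hjk : j < κ i
    · have h := hT.1 i j hjk
      simp only [fillFun, hjk, if_true]
      refine ⟨h.1, by omega, ?_⟩
      rw [show d + 1 - T i j = d - T i j + 1 by omega]
      exact h.2.2
    -- The new entry d + 1 is bounded by `L 0`, and the contents of these cells are less than `f 0`.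
    · simp only [fillFun, hjk, if_false, hj, if_true, Nat.sub_self]
      have : f i ≤ f 0 := hf (Nat.zero_le i)
      exact ⟨by omega, le_rfl, by omega⟩
  · have := hκ i
    simp [fillFun, show ¬ j < κ i by omega, show ¬ j < f i by omega]
  · by_cases hjk : j₂ < κ i
    · simp only [fillFun, hjk, h.trans hjk, if_true]
      exact hT.2.2.1 i j₁ j₂ h hjk
    · simp only [fillFun, hjk, if_false, hj, h.trans hj, if_true]
      split_ifs with h1
      · have := (hT.1 i j₁ h1).2.1
        omega
      · exact le_rfl
  · have h1 : j < κ i₁ := hj.trans_le (hanti i₁ i₂ h)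
    by_cases hjk : j < κ i₂
    · simp only [fillFun, hjk, h1, if_true]
      exact hT.2.2.2 i₁ i₂ j h hjk
    · simp only [fillFun, hjk, if_false, hj, h1, if_true]
      have := (hT.1 i₁ j h1).2.1
      omega

lemma extendZero_truncLen {d : ℕ} {L f : ℕ → ℕ} (hf : Antitone f) {T : ℕ → ℕ → ℕ}
    (hT : T ∈ tableauxFun (d + 1) L f) :
    extendZero (fun i : Fin d => truncLen d f T i) = truncLen d f T := by
  funext i
  rcases lt_or_ge i d with h | h
  · simp [extendZero, h]
  · simp [extendZero, not_lt.2 h, truncLen_eq_zero hf hT h]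

lemma extendZero_le {d : ℕ} {f : ℕ → ℕ} {κ : Fin d → ℕ}
    (hκ : κ ∈ Fintype.piFinset fun j : Fin d => Finset.Icc (f (j + 1)) (f j)) (i : ℕ) :
    extendZero κ i ≤ f i := by
  unfold extendZero
  split_ifs with h
  · exact (Finset.mem_Icc.1 (Fintype.mem_piFinset.1 hκ ⟨i, h⟩)).2
  · exact Nat.zero_le _

lemma le_extendZero {d : ℕ} {f : ℕ → ℕ} (hfd : ∀ i, d + 1 ≤ i → f i = 0) {κ : Fin d → ℕ}
    (hκ : κ ∈ Fintype.piFinset fun j : Fin d => Finset.Icc (f (j + 1)) (f j)) (i : ℕ) :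
    f (i + 1) ≤ extendZero κ i := by
  unfold extendZero
  split_ifs with h
  · exact (Finset.mem_Icc.1 (Fintype.mem_piFinset.1 hκ ⟨i, h⟩)).1
  · exact (hfd _ (by omega)).le

lemma truncLen_fillFun {d : ℕ} {L f κ : ℕ → ℕ} (hκ : ∀ i, κ i ≤ f i) {T : ℕ → ℕ → ℕ}
    (hT : T ∈ tableauxFun d L κ) : truncLen d f (fillFun (d + 1) f κ T) = κ := by
  funext i
  have : (Finset.range (f i)).filter (fun j => fillFun (d + 1) f κ T i j ≤ d) =
      Finset.range (κ i) := by
    ext j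
    simp only [Finset.mem_filter, Finset.mem_range]
    have hκi := hκ i
    by_cases hj : j < κ i
    · simp only [fillFun, hj, if_true, iff_true]
      exact ⟨by omega, (hT.1 i j hj).2.1⟩
    · simp only [fillFun, hj, if_false, iff_false]
      rintro ⟨h1, h2⟩
      rw [if_pos h1] at h2
      omega
  rw [truncLen, this, Finset.card_range]

lemma truncFun_fillFun {d : ℕ} {L f κ : ℕ → ℕ} {T : ℕ → ℕ → ℕ}
    (hT : T ∈ tableauxFun d L κ) : truncFun d (fillFun (d + 1) f κ T) = T := by
  funext i j
  by_cases hj : j < κ i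
  · simp [truncFun, fillFun, hj, (hT.1 i j hj).2.1]
  · rw [hT.2.1 i j (not_lt.1 hj)]
    by_cases hj' : j < f i <;> simp [truncFun, fillFun, hj, hj']

lemma fillFun_truncFun {d : ℕ} {L f : ℕ → ℕ} {T : ℕ → ℕ → ℕ}
    (hT : T ∈ tableauxFun (d + 1) L f) :
    fillFun (d + 1) f (truncLen d f T) (truncFun d T) = T := by
  funext i j
  have key := lt_truncLen_iff (hT.2.2.1 i) j (d := d)
  by_cases hj : j < f i
  · by_cases hj' : T i j ≤ d
    · simp [fillFun, key, hj, hj', truncFun]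
    · have := (hT.1 i j hj).2.1
      simp only [fillFun, key, hj, hj', and_false, if_false, if_true]
      omega
  · simp [fillFun, key, hj, hT.2.1 i j (not_lt.1 hj)]

/-- Removing the largest entry. -/
def tableauxFunEquiv {d : ℕ} {L f : ℕ → ℕ} (hf : Antitone f) (h0 : f 0 ≤ L 0)
    (hfd : ∀ i, d + 1 ≤ i → f i = 0) :
    tableauxFun (d + 1) L f ≃
      Σ κ : (Fintype.piFinset fun j : Fin d => Finset.Icc (f (j + 1)) (f j)),
        tableauxFun d (fun i => L (i + 1)) (extendZero κ.1) where
  toFun T := ⟨⟨fun i => truncLen d f T.1 i, Fintype.mem_piFinset.2 fun i =>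
      Finset.mem_Icc.2 ⟨truncLen_interlace hf T.2 i, truncLen_le d f T.1 i⟩⟩,
    ⟨truncFun d T.1, by
      rw [extendZero_truncLen hf T.2]
      exact truncFun_mem T.2⟩⟩
  invFun p := ⟨fillFun (d + 1) f (extendZero p.1.1) p.2.1,
    fillFun_mem hf h0 (extendZero_le p.1.2) (le_extendZero hfd p.1.2) p.2.2⟩
  left_inv T := by
    apply Subtype.ext
    change fillFun (d + 1) f (extendZero fun i : Fin d => truncLen d f T.1 i) (truncFun d T.1) = T.1
    rw [extendZero_truncLen hf T.2, fillFun_truncFun T.2]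
  right_inv p := by
    obtain ⟨⟨κ, hκ⟩, ⟨T, hT⟩⟩ := p
    have h1 : (fun i : Fin d => truncLen d f (fillFun (d + 1) f (extendZero κ) T) i) = κ := by
      funext i
      rw [truncLen_fillFun (extendZero_le hκ) hT]
      simp [extendZero]
    have h2 := truncFun_fillFun (f := f) hT
    refine Sigma.ext (Subtype.ext h1) ?_
    rw [Subtype.heq_iff_coe_eq]
    · exact h2
    · intro T'
      change T' ∈ tableauxFun d _ (extendZero fun i : Fin d => truncLen d f
        (fillFun (d + 1) f (extendZero κ) T) i) ↔ _
      rw [h1]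

/-- Both sides obey the same recursion over interlacing shapes and vanish when `L 0 < f 0`.
Finiteness is proved along the way, since counting the sigma type needs finite fibres. -/
lemma card_tableauxFun (d : ℕ) (L f : ℕ → ℕ) (hL : Antitone L) (hf : Antitone f)
    (hfd : ∀ i, d ≤ i → f i = 0) :
    (tableauxFun d L f).Finite ∧
      (Nat.card (tableauxFun d L f) : ℤ) =
        (flagMatrix d (bead L) (fun j => bead f j)).det := by
  induction d generalizing L f with
  | zero =>
    have : tableauxFun 0 L f = {fun _ _ => 0} := by
      ext T
      have hz : ∀ i, f i = 0 := fun i => hfd i (Nat.zero_le i)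
      simp only [tableauxFun, hz, Set.mem_ofPred_eq, Set.mem_singleton_iff]
      constructor
      · intro h
        funext i j
        exact h.2.1 i j (Nat.zero_le j)
      · rintro rfl
        simp
    rw [this]
    simp
  | succ d ih =>
    rcases le_or_gt (f 0) (L 0) with h0 | h0
    · have hL' : Antitone fun i => L (i + 1) := fun i j h => hL (Nat.succ_le_succ h)
      have ih' : ∀ κ : (Fintype.piFinset fun j : Fin d => Finset.Icc (f (j + 1)) (f j)), _ :=
        fun κ => ih (fun i => L (i + 1)) (extendZero κ.1) hL'
          (antitone_nat_of_succ_le fun i =>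
            (extendZero_le κ.2 (i + 1)).trans (le_extendZero hfd κ.2 i))
          (fun i hi => by simp [extendZero, not_lt.2 hi])
      have hfin : ∀ κ : (Fintype.piFinset fun j : Fin d => Finset.Icc (f (j + 1)) (f j)),
          Finite (tableauxFun d (fun i => L (i + 1)) (extendZero κ.1)) :=
        fun κ => (ih' κ).1
      refine ⟨Finite.of_equiv _ (tableauxFunEquiv hf h0 hfd).symm, ?_⟩
      rw [Nat.card_congr (tableauxFunEquiv hf h0 hfd), Nat.card_sigma,
        det_flagMatrix_succ d L f hf h0, ← Finset.sum_coe_sort _ fun κ =>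
          (flagMatrix d (bead fun i => L (i + 1)) fun j => bead (extendZero κ) j).det]
      push_cast
      exact Finset.sum_congr rfl fun κ _ => (ih' κ).2
    · rw [tableauxFun_eq_empty hL h0, det_flagMatrix_eq_zero d L f hL h0]
      simp

/-! ### The determinant for Young diagrams, and independence of the representing shape -/

lemma rowLen_antitone (μ : YoungDiagram) : Antitone μ.rowLen := fun i j h => μ.rowLen_anti i j h

lemma rowLen_mono {β α : YoungDiagram} (h : β ≤ α) (i : ℕ) : β.rowLen i ≤ α.rowLen i := by
  by_contra hlt
  push Not at hlt
  have := YoungDiagram.mem_iff_lt_rowLen.1 (h (YoungDiagram.mem_iff_lt_rowLen.2 hlt))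
  omega

lemma rowLen_eq_zero_iff (μ : YoungDiagram) (i : ℕ) : μ.rowLen i = 0 ↔ μ.colLen 0 ≤ i := by
  rw [← not_lt, ← YoungDiagram.mem_iff_lt_colLen, YoungDiagram.mem_iff_lt_rowLen]
  omega

lemma image_entry_ooTableaux (α β : YoungDiagram) :
    SemistandardYoungTableau.entry '' ooTableaux α β =
      tableauxFun (α.colLen 0) α.rowLen β.rowLen := by
  ext T
  constructor
  · rintro ⟨T, hT, rfl⟩
    refine ⟨fun i j h => hT i j (YoungDiagram.mem_iff_lt_rowLen.2 h), fun i j h => T.zeros' ?_,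
      fun i j₁ j₂ h h' => T.row_weak' h (YoungDiagram.mem_iff_lt_rowLen.2 h'),
      fun i₁ i₂ j h h' => T.col_strict' h (YoungDiagram.mem_iff_lt_rowLen.2 h')⟩
    rwa [YoungDiagram.mem_iff_lt_rowLen, not_lt]
  · intro hT
    refine ⟨⟨T, fun h h' => hT.2.2.1 _ _ _ h (YoungDiagram.mem_iff_lt_rowLen.1 h'),
      fun h h' => hT.2.2.2 _ _ _ h (YoungDiagram.mem_iff_lt_rowLen.1 h'),
      fun h => hT.2.1 _ _ ?_⟩, fun i j h => hT.1 i j (YoungDiagram.mem_iff_lt_rowLen.1 h), rfl⟩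
    rwa [YoungDiagram.mem_iff_lt_rowLen, not_lt] at h

lemma entry_injective (β : YoungDiagram) :
    Function.Injective (SemistandardYoungTableau.entry (μ := β)) := by
  rintro ⟨T, _, _, _⟩ ⟨T', _, _, _⟩ h
  cases h
  rfl

theorem oot_eq_det {α β : YoungDiagram} (h : β ≤ α) :
    (oot α β : ℤ) =
      (flagMatrix (α.colLen 0) (bead α.rowLen) (fun j => bead β.rowLen j)).det := by
  have hz : ∀ i, α.colLen 0 ≤ i → β.rowLen i = 0 := fun i hi => by
    have := rowLen_mono h i
    have := (rowLen_eq_zero_iff α i).2 hi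
    omega
  rw [← (card_tableauxFun (α.colLen 0) α.rowLen β.rowLen (rowLen_antitone α) (rowLen_antitone β)
    hz).2, oot, ← Set.ncard_image_of_injective _ (entry_injective β), image_entry_ooTableaux,
    Nat.card_coe_set_eq]

/-- For k < i, a (σ k) ≥ b k > b i = a i, so σ preserves the set of indices below i. The same
inequality at i gives σ i ≤ i, and the smaller values are already taken. -/
lemma flagMatrix_perm_fixes {d : ℕ} {a b : ℕ → ℤ} (ha : StrictAnti a) (hb : StrictAnti b)
    {σ : Equiv.Perm (Fin d)} (hσ : ∀ k : Fin d, b k ≤ a (σ k)) {i : Fin d} (hi : a i = b i) :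
    σ i = i := by
  have h1 : ∀ k : Fin d, k < i → σ k < i := fun k hk => by
    have : a i < a (σ k) := by
      rw [hi]
      exact (hb (Fin.lt_def.1 hk)).trans_le (hσ k)
    exact Fin.lt_def.2 (ha.lt_iff_gt.1 this)
  have h2 : σ i ≤ i := by
    have := hσ i
    rw [← hi] at this
    exact Fin.le_def.2 (ha.le_iff_ge.1 this)
  by_contra hne
  have h3 : (Finset.Iio i).image σ = Finset.Iio i := by
    refine Finset.eq_of_subset_of_card_le ?_ ?_
    · intro x hx
      obtain ⟨k, hk, rfl⟩ := Finset.mem_image.1 hx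
      exact Finset.mem_Iio.2 (h1 k (Finset.mem_Iio.1 hk))
    · rw [Finset.card_image_of_injective _ σ.injective]
  have h4 : σ i ∈ (Finset.Iio i).image σ := by
    rw [h3]
    exact Finset.mem_Iio.2 (lt_of_le_of_ne h2 hne)
  obtain ⟨k, hk, hk'⟩ := Finset.mem_image.1 h4
  exact (Finset.mem_Iio.1 hk).ne (σ.injective hk')

/-- Rows without cells do not contribute to the determinant. -/
lemma det_flagMatrix_eq_subtype {d : ℕ} {a b : ℕ → ℤ} (ha : StrictAnti a) (hb : StrictAnti b) :
    (flagMatrix d a (fun j => b j)).det =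
      (Matrix.of fun i j : {i : Fin d // a i ≠ b i} => flagH i (a i - b j)).det := by
  -- The block-diagonal modification with an identity block on the empty rows; its Leibniz expansion
  -- agrees term by term with the original one.
  let M' : Matrix (Fin d) (Fin d) ℤ := Matrix.of fun i j =>
    if a i ≠ b i ∧ a j ≠ b j then flagH i (a i - b j) else if i = j then 1 else 0
  have h1 : (flagMatrix d a (fun j => b j)).det = M'.det := by
    rw [Matrix.det_apply, Matrix.det_apply]
    refine Finset.sum_congr rfl fun σ _ => ?_
    congr 1
    by_cases hfix : ∀ i : Fin d, a i = b i → σ i = i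
    · refine Finset.prod_congr rfl fun i _ => ?_
      by_cases hi : a i = b i
      · simp [flagMatrix, M', hfix i hi, hi, flagH_zero_right]
      · have : a (σ i) ≠ b (σ i) := fun h => by
          rw [σ.injective (hfix _ h)] at h
          exact hi h
        simp [flagMatrix, M', hi, this]
    · have hz : ∏ i, flagMatrix d a (fun j => b j) (σ i) i = 0 := by
        by_contra hne
        rw [← ne_eq, Finset.prod_ne_zero_iff] at hne
        refine hfix fun i hi => flagMatrix_perm_fixes ha hb (fun k => ?_) hi
        by_contra hlt
        exact hne k (Finset.mem_univ k) (flagH_of_neg (sub_neg.2 (not_le.1 hlt)))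
      rw [hz]
      push Not at hfix
      obtain ⟨i, hi, hi'⟩ := hfix
      exact (Finset.prod_eq_zero (Finset.mem_univ i) (by simp [M', hi, hi'])).symm
  rw [h1, Matrix.twoBlockTriangular_det M' (fun i => a i ≠ b i)]
  · have h2 : Matrix.toSquareBlockProp M' (fun i => ¬ a i ≠ b i) = 1 := by
      ext ⟨i, hi⟩ ⟨j, hj⟩
      have hi' : a i = b i := not_not.1 hi
      simp [Matrix.toSquareBlockProp, M', hi', Matrix.one_apply]
    rw [h2, Matrix.det_one, mul_one]
    congr 1
    ext ⟨i, hi⟩ ⟨j, hj⟩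
    simp [Matrix.toSquareBlockProp, M', hi, hj]
  · intro i hi j hj
    have : i ≠ j := fun h => hi (h ▸ hj)
    simp [M', hi, this]

/-- Only the nonempty rows matter. They must keep their indices, because the row index fixes the
number of variables. -/
lemma det_flagMatrix_congr {d d' : ℕ} {a b a' b' : ℕ → ℤ} (ha : StrictAnti a) (hb : StrictAnti b)
    (ha' : StrictAnti a') (hb' : StrictAnti b') (hd : ∀ i, a i ≠ b i → i < d)
    (hd' : ∀ i, a' i ≠ b' i → i < d') (hne : ∀ i, a i ≠ b i ↔ a' i ≠ b' i)
    (haa : ∀ i, a i ≠ b i → a i = a' i) (hbb : ∀ i, a i ≠ b i → b i = b' i) :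
    (flagMatrix d a (fun j => b j)).det = (flagMatrix d' a' (fun j => b' j)).det := by
  rw [det_flagMatrix_eq_subtype ha hb, det_flagMatrix_eq_subtype ha' hb']
  let e : {i : Fin d // a i ≠ b i} ≃ {i : Fin d' // a' i ≠ b' i} :=
    { toFun := fun i => ⟨⟨i, hd' _ ((hne _).1 i.2)⟩, (hne _).1 i.2⟩
      invFun := fun i => ⟨⟨i, hd _ ((hne _).2 i.2)⟩, (hne _).2 i.2⟩
      left_inv := fun i => rfl
      right_inv := fun i => rfl }
  rw [← Matrix.det_submatrix_equiv_self e]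
  congr 1
  ext i j
  change flagH i.1 (a i.1 - b j.1) = flagH i.1 (a' i.1 - b' j.1)
  rw [haa _ i.2, hbb _ j.2]

lemma mem_skewCells {α β : YoungDiagram} {i j : ℕ} :
    (i, j) ∈ skewCells α β ↔ β.rowLen i ≤ j ∧ j < α.rowLen i := by
  change (i, j) ∈ α ∧ (i, j) ∉ β ↔ _
  rw [YoungDiagram.mem_iff_lt_rowLen, YoungDiagram.mem_iff_lt_rowLen]
  omega

lemma bead_ne_iff {α β : YoungDiagram} (h : β ≤ α) (i : ℕ) :
    bead α.rowLen i ≠ bead β.rowLen i ↔ β.rowLen i < α.rowLen i := by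
  have := rowLen_mono h i
  simp only [bead]
  omega

lemma lt_colLen_of_bead_ne {α β : YoungDiagram} (h : β ≤ α) (i : ℕ)
    (hi : bead α.rowLen i ≠ bead β.rowLen i) : i < α.colLen 0 := by
  have := rowLen_eq_zero_iff α i
  have := (bead_ne_iff h i).1 hi
  omega

/-- `OOT(α/β)` only depends on the set of cells `[α/β]`. -/
theorem oot_congr {α β α' β' : YoungDiagram} (h : β ≤ α) (h' : β' ≤ α')
    (hs : skewCells α β = skewCells α' β') : oot α β = oot α' β' := by
  have key : ∀ i j, (β.rowLen i ≤ j ∧ j < α.rowLen i) ↔ (β'.rowLen i ≤ j ∧ j < α'.rowLen i) :=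
    fun i j => by rw [← mem_skewCells, ← mem_skewCells, hs]
  have hlt : ∀ i, β.rowLen i < α.rowLen i →
      α.rowLen i = α'.rowLen i ∧ β.rowLen i = β'.rowLen i := fun i hi => by
    have h1 := (key i (β.rowLen i)).1 ⟨le_rfl, hi⟩
    have h2 := (key i (α.rowLen i - 1)).1 ⟨by omega, by omega⟩
    have h3 := (key i (β'.rowLen i)).2 ⟨le_rfl, by omega⟩
    have h4 := (key i (α'.rowLen i - 1)).2 ⟨by omega, by omega⟩
    omega
  zify
  rw [oot_eq_det h, oot_eq_det h']
  refine det_flagMatrix_congr (bead_strictAnti (rowLen_antitone α))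
    (bead_strictAnti (rowLen_antitone β)) (bead_strictAnti (rowLen_antitone α'))
    (bead_strictAnti (rowLen_antitone β')) (lt_colLen_of_bead_ne h) (lt_colLen_of_bead_ne h')
    (fun i => ?_) (fun i hi => ?_) (fun i hi => ?_)
  · rw [bead_ne_iff h, bead_ne_iff h']
    constructor
    · intro hi
      have := hlt i hi
      omega
    · intro hi
      have := (key i (β'.rowLen i)).2 ⟨le_rfl, hi⟩
      omega
  · simp only [bead, (hlt i ((bead_ne_iff h i).1 hi)).1]
  · simp only [bead, (hlt i ((bead_ne_iff h i).1 hi)).2]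

theorem ootOfCells_eq {α β : YoungDiagram} (h : β ≤ α) {S : Set (ℕ × ℕ)}
    (hs : skewCells α β = S) : ootOfCells S = oot α β := by
  have hex : ∃ p : YoungDiagram × YoungDiagram, p.2 ≤ p.1 ∧ skewCells p.1 p.2 = S :=
    ⟨(α, β), h, hs⟩
  rw [ootOfCells, dif_pos hex]
  exact oot_congr hex.choose_spec.1 h (hex.choose_spec.2.trans hs.symm)

/-! ### Minors: sorting, relative Giambelli formula, border strips -/

/-- Sorting the columns of a Jacobi--Trudi matrix. -/
lemma det_flagMatrix_sort {d : ℕ} (a : ℕ → ℤ) {b : ℕ → ℤ} (hb : StrictAnti b) {β : Fin d → ℤ}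
    (hβ : Function.Injective β) (hβb : ∀ i, ∃ j : Fin d, β i = b j) :
    (flagMatrix d a β).det =
      (∏ i, ∏ j ∈ Finset.Ioi i, if β i < β j then -1 else 1) *
        (flagMatrix d a (fun j => b j)).det := by
  choose τ hτ using hβb
  have hinj : Function.Injective τ := fun i j h => hβ (by rw [hτ, hτ, h])
  let σ : Equiv.Perm (Fin d) := Equiv.ofBijective τ (Finite.injective_iff_bijective.1 hinj)
  have hσ : ∀ i, β i = b (σ i) := hτ
  have h1 : flagMatrix d a β = (flagMatrix d a (fun j => b j)).submatrix id σ := by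
    ext i j
    simp [flagMatrix, hσ]
  rw [h1, Matrix.det_permute', Equiv.Perm.sign_eq_prod_prod_Ioi]
  congr 1
  push_cast
  refine Finset.prod_congr rfl fun i _ => Finset.prod_congr rfl fun j hj => ?_
  have hij : σ i ≠ σ j := fun h => (Finset.mem_Ioi.1 hj).ne (σ.injective h)
  rw [hσ, hσ]
  rcases lt_or_gt_of_ne hij with h | h
  · have := hb (Fin.lt_def.1 h)
    rw [if_pos h, if_neg (by omega)]
    rfl
  · have := hb (Fin.lt_def.1 h)
    rw [if_neg (not_lt.2 h.le), if_pos this]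
    rfl

lemma det_flagMatrix_self {d : ℕ} {a : ℕ → ℤ} (ha : StrictAnti a) :
    (flagMatrix d a (fun j => a j)).det = 1 := by
  rw [Matrix.det_of_isUpperTriangular]
  · simp [flagMatrix, flagH_zero_right]
  · intro i j h
    have := ha (Fin.lt_def.1 h)
    exact flagH_of_neg (sub_neg.2 this)

/-- Replacing one bead. -/
def replaceBead {d : ℕ} (a : ℕ → ℤ) (i : Fin d) (x : ℤ) : Fin d → ℤ :=
  Function.update (fun j : Fin d => a j) i x

/-- The matrix stays upper triangular but gets a zero on the diagonal. This is the case of an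
undefined θ_i # θ_j. -/
lemma det_replaceBead_eq_zero {d : ℕ} {a : ℕ → ℤ} (ha : StrictAnti a) {i : Fin d} {x : ℤ}
    (hx : a i < x) : (flagMatrix d a (replaceBead a i x)).det = 0 := by
  rw [Matrix.det_of_isUpperTriangular]
  · refine Finset.prod_eq_zero (Finset.mem_univ i) (flagH_of_neg ?_)
    simp only [replaceBead, Function.update_self]
    omega
  · intro k j h
    have hkj : a k < a j := ha (Fin.lt_def.1 h)
    refine flagH_of_neg ?_
    by_cases hj : j = i
    · subst hj
      simp only [replaceBead, Function.update_self]
      omega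
    · simp only [replaceBead, Function.update_of_ne hj]
      omega

/-- The relative Giambelli formula: a maximal minor in terms of those obtained by replacing a
single column of the identity minor. -/
lemma det_flagMatrix_eq_det_replaceBead {d n : ℕ} {a : ℕ → ℤ} (ha : StrictAnti a) {β : Fin d → ℤ}
    {idx : Fin n → Fin d} (hidx : Function.Injective idx)
    (hβ : ∀ i, i ∉ Set.range idx → β i = a i) :
    (flagMatrix d a β).det = (Matrix.of fun s s' : Fin n =>
      (flagMatrix d a (replaceBead a (idx s') (β (idx s)))).det).det := by
  classical
  set A := flagMatrix d a (fun j => a j) with hA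
  have hupd : ∀ (k : Fin d) (x : ℤ), (A.updateCol k fun i => flagH i (a i - x)) =
      flagMatrix d a (replaceBead a k x) := by
    intro k x
    ext i j
    by_cases hj : j = k
    · subst hj
      simp [flagMatrix, replaceBead]
    · simp [hA, flagMatrix, replaceBead, hj]
  -- Column i of `W` holds the coordinates, by Cramer's rule, of the column at β i in the basis of
  -- columns of `A`. Unreplaced columns give unit vectors, so only an n × n block survives.
  let W : Matrix (Fin d) (Fin d) ℤ := Matrix.of fun k i =>
    A.cramer (fun l => flagH l (a l - β i)) k
  have hW : ∀ k i, W k i = (flagMatrix d a (replaceBead a k (β i))).det := by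
    intro k i
    simp only [W, Matrix.of_apply, Matrix.cramer_apply, hupd]
  have hdet : A.det = 1 := det_flagMatrix_self ha
  have hmul : flagMatrix d a β = A * W := by
    ext l i
    have := congrFun (A.mulVec_cramer (fun l => flagH l (a l - β i))) l
    rw [hdet, one_smul] at this
    exact this.symm
  have hcol : ∀ k i, i ∉ Set.range idx → W k i = if k = i then 1 else 0 := by
    intro k i hi
    have h1 : (fun l : Fin d => flagH l (a l - β i)) = fun l => A l i := by
      funext l
      rw [hβ i hi]
      rfl
    simp only [W, Matrix.of_apply, h1]
    rw [A.cramer_row_self _ i fun _ => rfl, hdet, Pi.single_apply]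
  rw [hmul, Matrix.det_mul, hdet, one_mul,
    Matrix.twoBlockTriangular_det' W (fun i => ∃ s, idx s = i)]
  · have h2 : Matrix.toSquareBlockProp W (fun i => ¬ ∃ s, idx s = i) = 1 := by
      ext ⟨i, hi⟩ ⟨j, hj⟩
      simp only [Matrix.toSquareBlockProp, Matrix.toBlock_apply, hcol _ _ hj, Matrix.one_apply,
        Subtype.mk.injEq]
    let e : Fin n ≃ {i // ∃ s, idx s = i} := Equiv.ofInjective idx hidx
    rw [h2, Matrix.det_one, mul_one, ← Matrix.det_transpose, ← Matrix.det_submatrix_equiv_self e]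
    congr 1
    ext s s'
    simp only [Matrix.submatrix_apply, Matrix.transpose_apply, Matrix.of_apply, ← hW]
    rfl
  · intro i hi j hj
    rw [hcol _ _ hj, if_neg]
    rintro rfl
    exact hj hi

/-- The beads of the shape obtained by removing the border strip with contents from `x + 1` to
`a i`. -/
def stripBead (a : ℕ → ℤ) (i : ℕ) (x : ℤ) (r : ℕ) : ℤ :=
  if r < i then a r else min (a r) (max (a (r + 1)) x)

lemma stripBead_le (a : ℕ → ℤ) (i : ℕ) (x : ℤ) (r : ℕ) : stripBead a i x r ≤ a r := by
  unfold stripBead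
  split_ifs <;> omega

/-- If x < a i, the sequence is `a` with a i deleted and x inserted in its sorted place. The
assumption `hx` prevents a collision. -/
lemma stripBead_strictAnti {a : ℕ → ℤ} (ha : StrictAnti a) {x : ℤ} (hx : x ∉ Set.range a) (i : ℕ) :
    StrictAnti (stripBead a i x) := by
  refine strictAnti_nat_of_succ_lt fun r => ?_
  have h1 := ha (Nat.lt_succ_self r)
  have h2 := ha (Nat.lt_succ_self (r + 1))
  have h3 : a (r + 1) ≠ x := fun h => hx ⟨_, h⟩
  simp only [Nat.succ_eq_add_one] at h1 h2
  unfold stripBead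
  split_ifs <;> omega

/-- Replacing a bead by a smaller one is, up to a sign, removing a border strip. -/
lemma det_replaceBead {d : ℕ} {a : ℕ → ℤ} (ha : StrictAnti a)
    (had : ∀ p, d ≤ p → a (p + 1) = a p - 1) {x : ℤ} (hx : x ∉ Set.range a) {i : Fin d}
    (hi : x < a i) :
    (flagMatrix d a (replaceBead a i x)).det =
      (∏ l ∈ Finset.Ioi i, if x < a l then -1 else 1) *
        (flagMatrix d a (fun r => stripBead a i x r)).det := by
  have hself : replaceBead a i x i = x := by simp [replaceBead]
  have hother : ∀ j, j ≠ i → replaceBead a i x j = a j := fun j hj => by simp [replaceBead, hj]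
  have hxa : ∀ j, a j ≠ x := fun j h => hx ⟨j, h⟩
  rw [det_flagMatrix_sort a (stripBead_strictAnti ha hx i)]
  · congr 1
    rw [Finset.prod_eq_single i]
    · refine Finset.prod_congr rfl fun l hl => ?_
      rw [hself, hother l (Finset.mem_Ioi.1 hl).ne']
    · intro k _ hk
      refine Finset.prod_eq_one fun l hl => if_neg ?_
      have hkl := Finset.mem_Ioi.1 hl
      rw [hother k hk]
      by_cases hl' : l = i
      · subst hl'
        have := ha (Fin.lt_def.1 hkl)
        rw [hself]
        omega
      · rw [hother l hl']
        have := ha (Fin.lt_def.1 hkl)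
        omega
    · simp
  · intro k l h
    by_cases hk : k = i <;> by_cases hl : l = i
    · rw [hk, hl]
    · subst hk
      rw [hself, hother l hl] at h
      exact absurd h.symm (hxa l)
    · subst hl
      rw [hself, hother k hk] at h
      exact absurd h (hxa k)
    · rw [hother k hk, hother l hl] at h
      exact Fin.ext (ha.injective h)
  · have hlow : ∀ p : ℕ, a p ≤ a 0 - p := by
      intro p
      induction p with
      | zero => simp
      | succ p ih =>
        have := ha (Nat.lt_succ_self p)
        push_cast
        simp only [Nat.succ_eq_add_one] at this
        omega
    intro k
    by_cases hk : k = i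
    · subst hk
      have hex : ∃ p, a p < x := ⟨(a 0 - x + 1).toNat, by
        have := hlow (a 0 - x + 1).toNat
        omega⟩
      classical
      obtain ⟨q, hq⟩ : ∃ q, Nat.find hex = q + 1 := by
        refine ⟨Nat.find hex - 1, ?_⟩
        have h1 := Nat.find_spec hex
        have h2 : (k : ℕ) < Nat.find hex := by
          by_contra hcon
          have := ha.antitone (not_lt.1 hcon)
          omega
        omega
      have h1 : a (q + 1) < x := hq ▸ Nat.find_spec hex
      have h2 : x < a q := by
        have := Nat.find_min hex (m := q) (by omega)
        have := hxa q
        omega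
      have h3 : (k : ℕ) ≤ q := by
        by_contra hcon
        have := ha.antitone (show q + 1 ≤ k by omega)
        omega
      -- Beyond `d` the beads are consecutive integers, which leaves no gap for x.
      have h4 : q < d := by
        by_contra hcon
        have := had q (not_lt.1 hcon)
        omega
      refine ⟨⟨q, h4⟩, ?_⟩
      simp only [hself, stripBead, not_lt.2 h3, if_false]
      omega
    · rw [hother k hk]
      rcases lt_or_gt_of_ne hk with h | h
      · exact ⟨k, by simp [stripBead, Fin.lt_def.1 h]⟩
      · by_cases hxk : x < a k
        · have hlt := Fin.lt_def.1 h
          refine ⟨⟨k - 1, by omega⟩, ?_⟩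
          have h1 := ha (show (k : ℕ) - 1 < k by omega)
          simp only [stripBead, show ¬ (k : ℕ) - 1 < i by omega, if_false,
            show (k : ℕ) - 1 + 1 = k by omega]
          omega
        · have := ha (Nat.lt_succ_self k)
          refine ⟨k, ?_⟩
          simp only [stripBead, not_lt.2 (Fin.lt_def.1 h).le, if_false]
          have := hxa k
          simp only [Nat.succ_eq_add_one] at *
          omega

/-- Splits the sign into a factor depending only on x and one depending only on i, so that both can
be pulled out of the determinant, from rows and columns respectively. -/
lemma prod_Ioi_sign {d : ℕ} {a : ℕ → ℤ} (ha : StrictAnti a) {x : ℤ} {i : Fin d} (hi : x < a i) :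
    (∏ l ∈ Finset.Ioi i, if x < a l then (-1 : ℤ) else 1) =
      (∏ l : Fin d, if x < a l then (-1 : ℤ) else 1) * (-1) ^ ((i : ℕ) + 1) := by
  have h1 : (Finset.Iic i)ᶜ = Finset.Ioi i := by
    ext l
    simp
  have h2 : (∏ l ∈ Finset.Iic i, if x < a l then (-1 : ℤ) else 1) = (-1) ^ ((i : ℕ) + 1) := by
    rw [← Fin.card_Iic i, ← Finset.prod_const]
    refine Finset.prod_congr rfl fun l hl => if_pos ?_
    exact hi.trans_le (ha.antitone (Fin.le_def.1 (Finset.mem_Iic.1 hl)))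
  rw [← Finset.prod_mul_prod_compl (Finset.Iic i), h1, h2, mul_comm, ← mul_assoc, ← mul_pow]
  norm_num

lemma bead_rowLen_strictAnti (μ : YoungDiagram) : StrictAnti (bead μ.rowLen) :=
  bead_strictAnti (rowLen_antitone μ)

/-! ### Diagonals and the components of the translated strips -/

/-- The number of rows of `μ` whose last cell has content at least `c`. -/
noncomputable def beadCount (μ : YoungDiagram) (c : ℤ) : ℕ := sInf {i | bead μ.rowLen i < c}

lemma lt_beadCount_iff (μ : YoungDiagram) (c : ℤ) (i : ℕ) :
    i < beadCount μ c ↔ c ≤ bead μ.rowLen i := by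
  have hne : {i | bead μ.rowLen i < c}.Nonempty := by
    refine ⟨(μ.rowLen 0 - c).toNat, ?_⟩
    have := μ.rowLen_anti 0 (μ.rowLen 0 - c).toNat (Nat.zero_le _)
    change bead _ _ < c
    simp only [bead]
    omega
  have hmem : bead μ.rowLen (beadCount μ c) < c := Nat.sInf_mem hne
  constructor
  · intro h
    exact not_lt.1 (Nat.notMem_of_lt_sInf h)
  · intro h
    exact (bead_rowLen_strictAnti μ).lt_iff_gt.1 (hmem.trans_le h)

lemma beadCount_eq_succ {μ : YoungDiagram} {c : ℤ} (hc : c ∈ Set.range (bead μ.rowLen)) :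
    beadCount μ c = beadCount μ (c + 1) + 1 := by
  obtain ⟨p, rfl⟩ := hc
  have hlt : ∀ i j, bead μ.rowLen i < bead μ.rowLen j ↔ j < i :=
    fun i j => (bead_rowLen_strictAnti μ).lt_iff_gt
  have h1 : beadCount μ (bead μ.rowLen p) = p + 1 := by
    refine eq_of_forall_lt_iff fun i => ?_
    have := hlt i p
    rw [lt_beadCount_iff]
    omega
  have h2 : beadCount μ (bead μ.rowLen p + 1) = p := by
    refine eq_of_forall_lt_iff fun i => ?_
    have := hlt p i
    rw [lt_beadCount_iff]
    omega
  omega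

lemma beadCount_eq {μ : YoungDiagram} {c : ℤ} (hc : c ∉ Set.range (bead μ.rowLen)) :
    beadCount μ c = beadCount μ (c + 1) := by
  refine eq_of_forall_lt_iff fun i => ?_
  rw [lt_beadCount_iff, lt_beadCount_iff]
  have : bead μ.rowLen i ≠ c := fun h => hc ⟨i, h⟩
  omega

lemma mem_iff_content_le {μ : YoungDiagram} {p : ℕ × ℕ} :
    p ∈ μ ↔ content p ≤ bead μ.rowLen p.1 := by
  obtain ⟨i, j⟩ := p
  rw [YoungDiagram.mem_iff_lt_rowLen]
  simp only [content, bead]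
  omega

/-- Each diagonal meets the diagram in an initial run ending just before row `beadCount`. Membership
in the border strip and in its translates thus becomes arithmetic of these counts. -/
lemma mem_iff_lt_beadCount {μ : YoungDiagram} {p : ℕ × ℕ} :
    p ∈ μ ↔ p.1 < beadCount μ (content p) := by
  rw [lt_beadCount_iff, mem_iff_content_le]

lemma content_diag (p : ℕ × ℕ) : content (p.1 + 1, p.2 + 1) = content p := by
  simp only [content]
  omega

lemma mem_borderStrip_iff {lam : YoungDiagram} {p : ℕ × ℕ} :
    p ∈ borderStrip lam ↔ p.1 + 1 = beadCount lam (content p) := by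
  change p ∈ lam ∧ (p.1 + 1, p.2 + 1) ∉ lam ↔ _
  rw [mem_iff_lt_beadCount, mem_iff_lt_beadCount, content_diag]
  simp only
  omega

lemma mem_skewCells_iff_beadCount {lam mu : YoungDiagram} {p : ℕ × ℕ} :
    p ∈ skewCells lam mu ↔ beadCount mu (content p) ≤ p.1 ∧ p.1 < beadCount lam (content p) := by
  change p ∈ lam ∧ p ∉ mu ↔ _
  rw [mem_iff_lt_beadCount, mem_iff_lt_beadCount]
  omega

/-- The contents that occur in the intersection of `[lam/mu]` with the translate of the cutting
strip by `(k, k)`. -/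
def OccursAt (lam mu : YoungDiagram) (k c : ℤ) : Prop :=
  k ≤ 0 ∧ (beadCount mu c : ℤ) < beadCount lam c + k

/-- Guarantees a nonnegative column when a cell is rebuilt from its content and row. -/
lemma neg_beadCount_le (μ : YoungDiagram) (c : ℤ) : -(beadCount μ c : ℤ) ≤ c := by
  have h := (lt_beadCount_iff μ c (beadCount μ c)).not.1 (lt_irrefl _)
  simp only [bead] at h
  omega

lemma mem_shiftedIntersection_iff {lam mu : YoungDiagram} {k : ℤ} {p : ℕ × ℕ} :
    p ∈ shiftedIntersection lam mu k ↔
      OccursAt lam mu k (content p) ∧ (p.1 : ℤ) = beadCount lam (content p) - 1 + k := by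
  constructor
  · rintro ⟨hp, u, ⟨hu, -⟩, h1, h2⟩
    have hc : content u = content p := by
      simp only [content]
      omega
    rw [mem_borderStrip_iff, hc] at hu
    rw [mem_skewCells_iff_beadCount] at hp
    exact ⟨⟨by omega, by omega⟩, by omega⟩
  · rintro ⟨⟨hk, hlt⟩, h1⟩
    have hp : p ∈ skewCells lam mu := by
      rw [mem_skewCells_iff_beadCount]
      omega
    have hc : content ((p.1 - k).toNat, (p.2 - k).toNat) = content p := by
      simp only [content]
      omega
    refine ⟨hp, ((p.1 - k).toNat, (p.2 - k).toNat), ⟨?_, p, hp, p, hp, hc.ge, hc.le⟩, ?_, ?_⟩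
    · rw [mem_borderStrip_iff, hc]
      simp only
      omega
    · simp only
      omega
    · simp only
      omega

lemma OccursAt.exists_mem {lam mu : YoungDiagram} {k c : ℤ} (h : OccursAt lam mu k c) :
    ∃ p ∈ shiftedIntersection lam mu k, content p = c := by
  have h1 := neg_beadCount_le mu c
  obtain ⟨hk, hlt⟩ := h
  have hc : content ((beadCount lam c - 1 + k).toNat, (beadCount lam c - 1 + k + c).toNat) = c := by
    simp only [content]
    omega
  refine ⟨_, ?_, hc⟩
  rw [mem_shiftedIntersection_iff, hc]
  exact ⟨⟨hk, hlt⟩, by simp only; omega⟩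

lemma eq_of_mem_shiftedIntersection {lam mu : YoungDiagram} {k : ℤ} {p q : ℕ × ℕ}
    (hp : p ∈ shiftedIntersection lam mu k) (hq : q ∈ shiftedIntersection lam mu k)
    (h : content p = content q) : p = q := by
  have h1 := (mem_shiftedIntersection_iff.1 hp).2
  have h2 := (mem_shiftedIntersection_iff.1 hq).2
  rw [h] at h1
  simp only [content] at h
  exact Prod.ext (by omega) (by omega)

lemma cellAdj_of_content {lam mu : YoungDiagram} {k : ℤ} {p q : ℕ × ℕ}
    (hp : p ∈ shiftedIntersection lam mu k) (hq : q ∈ shiftedIntersection lam mu k)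
    (h : content q = content p + 1) : CellAdj p q := by
  have h1 := (mem_shiftedIntersection_iff.1 hp).2
  have h2 := (mem_shiftedIntersection_iff.1 hq).2
  rw [h] at h2
  have h3 : beadCount lam (content p) = beadCount lam (content p + 1) ∨
      beadCount lam (content p) = beadCount lam (content p + 1) + 1 := by
    by_cases hc : content p ∈ Set.range (bead lam.rowLen)
    · exact Or.inr (beadCount_eq_succ hc)
    · exact Or.inl (beadCount_eq hc)
  simp only [content] at h
  unfold CellAdj
  omega

lemma CellAdj.symm {p q : ℕ × ℕ} (h : CellAdj p q) : CellAdj q p := by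
  unfold CellAdj at *
  omega

lemma CellAdj.content {p q : ℕ × ℕ} (h : CellAdj p q) :
    content q = content p + 1 ∨ content p = content q + 1 := by
  unfold CellAdj at h
  simp only [OkounkovOlshanski.content]
  omega

/-- Each level has one cell per occurring content, and consecutive contents give adjacent cells.
Components are therefore runs of contents. -/
lemma mem_component_of_occursAt {lam mu : YoungDiagram} {k : ℤ} {p : ℕ × ℕ}
    (hp : p ∈ shiftedIntersection lam mu k) (N : ℕ) (v : ℕ × ℕ)
    (hv : v ∈ shiftedIntersection lam mu k) (hN : (content v - content p).natAbs = N)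
    (hocc : ∀ c, min (content p) (content v) ≤ c → c ≤ max (content p) (content v) →
      OccursAt lam mu k c) : v ∈ component (shiftedIntersection lam mu k) p := by
  induction N generalizing v with
  | zero =>
    rw [eq_of_mem_shiftedIntersection hv hp (by omega)]
    exact Relation.ReflTransGen.refl
  | succ N ih =>
    rcases lt_or_gt_of_ne (show content v ≠ content p by omega) with h | h
    · obtain ⟨w, hw, hwc⟩ := (hocc (content v + 1) (by omega) (by omega)).exists_mem
      exact Relation.ReflTransGen.tail
        (ih w hw (by omega) fun c h1 h2 => hocc c (by omega) (by omega))
        ⟨hw, hv, (cellAdj_of_content hv hw hwc).symm⟩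
    · obtain ⟨w, hw, hwc⟩ := (hocc (content v - 1) (by omega) (by omega)).exists_mem
      exact Relation.ReflTransGen.tail
        (ih w hw (by omega) fun c h1 h2 => hocc c (by omega) (by omega))
        ⟨hw, hv, cellAdj_of_content hw hv (by omega)⟩

lemma occursAt_of_mem_component {lam mu : YoungDiagram} {k : ℤ} {p v : ℕ × ℕ}
    (hp : p ∈ shiftedIntersection lam mu k)
    (hv : v ∈ component (shiftedIntersection lam mu k) p) :
    v ∈ shiftedIntersection lam mu k ∧
      ∀ c, min (content p) (content v) ≤ c → c ≤ max (content p) (content v) →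
        OccursAt lam mu k c := by
  induction hv with
  | refl =>
    refine ⟨hp, fun c h1 h2 => ?_⟩
    rw [show c = content p by omega]
    exact (mem_shiftedIntersection_iff.1 hp).1
  | @tail x y _ hxy ih =>
    refine ⟨hxy.2.1, fun c h1 h2 => ?_⟩
    by_cases hc : c = content y
    · rw [hc]
      exact (mem_shiftedIntersection_iff.1 hxy.2.1).1
    · have := hxy.2.2.content
      exact ih.2 c (by omega) (by omega)

/-- `[m, M]` is a maximal interval of contents that occur at level `k`. -/
structure IsStripInterval (lam mu : YoungDiagram) (k m M : ℤ) : Prop where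
  le : m ≤ M
  occurs : ∀ c, m ≤ c → c ≤ M → OccursAt lam mu k c
  not_pred : ¬ OccursAt lam mu k (m - 1)
  not_succ : ¬ OccursAt lam mu k (M + 1)

lemma isStripInterval_component {lam mu : YoungDiagram} {k m M : ℤ} {p : ℕ × ℕ}
    (hp : p ∈ shiftedIntersection lam mu k)
    (hm : IsLeast (content '' component (shiftedIntersection lam mu k) p) m)
    (hM : IsGreatest (content '' component (shiftedIntersection lam mu k) p) M) :
    IsStripInterval lam mu k m M ∧ m ≤ content p ∧ content p ≤ M ∧
      component (shiftedIntersection lam mu k) p =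
        {v | v ∈ shiftedIntersection lam mu k ∧ m ≤ content v ∧ content v ≤ M} := by
  have hpp : content p ∈ content '' component (shiftedIntersection lam mu k) p :=
    ⟨p, Relation.ReflTransGen.refl, rfl⟩
  have hmp := hm.2 hpp
  have hpM := hM.2 hpp
  have hocc : ∀ c, m ≤ c → c ≤ M → OccursAt lam mu k c := by
    intro c h1 h2
    obtain ⟨v, hv, hvm⟩ := hm.1
    obtain ⟨w, hw, hwM⟩ := hM.1
    rcases le_total c (content p) with h | h
    · exact (occursAt_of_mem_component hp hv).2 c (by omega) (by omega)
    · exact (occursAt_of_mem_component hp hw).2 c (by omega) (by omega)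
  refine ⟨⟨hmp.trans hpM, hocc, fun h => ?_, fun h => ?_⟩, hmp, hpM, ?_⟩
  · obtain ⟨q, hq, hqc⟩ := h.exists_mem
    have : q ∈ component (shiftedIntersection lam mu k) p :=
      mem_component_of_occursAt hp _ q hq rfl fun c h1 h2 => by
        by_cases hc : c = m - 1
        · rwa [hc]
        · exact hocc c (by omega) (by omega)
    have := hm.2 ⟨q, this, hqc⟩
    omega
  · obtain ⟨q, hq, hqc⟩ := h.exists_mem
    have : q ∈ component (shiftedIntersection lam mu k) p :=
      mem_component_of_occursAt hp _ q hq rfl fun c h1 h2 => by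
        by_cases hc : c = M + 1
        · rwa [hc]
        · exact hocc c (by omega) (by omega)
    have := hM.2 ⟨q, this, hqc⟩
    omega
  · ext v
    constructor
    · intro hv
      exact ⟨(occursAt_of_mem_component hp hv).1, hm.2 ⟨v, hv, rfl⟩, hM.2 ⟨v, hv, rfl⟩⟩
    · rintro ⟨hv, h1, h2⟩
      exact mem_component_of_occursAt hp _ v hv rfl fun c h3 h4 => hocc c (by omega) (by omega)

lemma beadCount_sub_succ (lam mu : YoungDiagram) (c : ℤ) :
    (c ∈ Set.range (bead lam.rowLen) ∧ beadCount lam c = beadCount lam (c + 1) + 1 ∨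
      c ∉ Set.range (bead lam.rowLen) ∧ beadCount lam c = beadCount lam (c + 1)) ∧
    (c ∈ Set.range (bead mu.rowLen) ∧ beadCount mu c = beadCount mu (c + 1) + 1 ∨
      c ∉ Set.range (bead mu.rowLen) ∧ beadCount mu c = beadCount mu (c + 1)) := by
  constructor
  · by_cases hc : c ∈ Set.range (bead lam.rowLen)
    · exact Or.inl ⟨hc, beadCount_eq_succ hc⟩
    · exact Or.inr ⟨hc, beadCount_eq hc⟩
  · by_cases hc : c ∈ Set.range (bead mu.rowLen)
    · exact Or.inl ⟨hc, beadCount_eq_succ hc⟩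
    · exact Or.inr ⟨hc, beadCount_eq hc⟩

/-- From M to M + 1 the difference of the two bead counts must drop, and it drops by at most one.
This happens only at a bead of `lam` that is not a bead of `mu`, and it fixes the level k. -/
lemma IsStripInterval.right_mem {lam mu : YoungDiagram} {k m M : ℤ}
    (h : IsStripInterval lam mu k m M) :
    M ∈ Set.range (bead lam.rowLen) ∧ M ∉ Set.range (bead mu.rowLen) ∧
      k = beadCount mu M + 1 - beadCount lam M := by
  have h1 := h.occurs M h.le le_rfl
  have h2 := h.not_succ
  unfold OccursAt at h1 h2
  rcases beadCount_sub_succ lam mu M with ⟨⟨h3, h3'⟩ | ⟨h3, h3'⟩, ⟨h4, h4'⟩ | ⟨h4, h4'⟩⟩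
  · omega
  · exact ⟨h3, h4, by omega⟩
  · omega
  · omega

lemma IsStripInterval.left_mem {lam mu : YoungDiagram} {k m M : ℤ}
    (h : IsStripInterval lam mu k m M) :
    m - 1 ∉ Set.range (bead lam.rowLen) ∧ m - 1 ∈ Set.range (bead mu.rowLen) ∧
      k = beadCount mu m + 1 - beadCount lam m := by
  have h1 := h.occurs m le_rfl h.le
  have h2 := h.not_pred
  have h5 := beadCount_sub_succ lam mu (m - 1)
  unfold OccursAt at h1 h2
  rw [sub_add_cancel] at h5
  rcases h5 with ⟨⟨h3, h3'⟩ | ⟨h3, h3'⟩, ⟨h4, h4'⟩ | ⟨h4, h4'⟩⟩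
  · omega
  · omega
  · exact ⟨h3, h4, by omega⟩
  · omega

lemma IsStripInterval.right_le_of_overlap {lam mu : YoungDiagram} {k m M M' m' : ℤ}
    (h : IsStripInterval lam mu k m M) (h' : IsStripInterval lam mu k m' M') (h1 : m ≤ M' + 1) :
    M ≤ M' := by
  by_contra hlt
  exact h'.not_succ (h.occurs _ h1 (by omega))

lemma IsStripInterval.left_le_of_overlap {lam mu : YoungDiagram} {k m M M' m' : ℤ}
    (h : IsStripInterval lam mu k m M) (h' : IsStripInterval lam mu k m' M') (h1 : m' - 1 ≤ M) :
    m' ≤ m := by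
  by_contra hlt
  exact h'.not_pred (h.occurs _ (by omega) h1)

/-- The sets of contents at different levels are nested. A crossing would give k < k' at content m -
1 and k' < k at content M' + 1. -/
lemma IsStripInterval.not_cross {lam mu : YoungDiagram} {k k' m M m' M' : ℤ}
    (h : IsStripInterval lam mu k m M) (h' : IsStripInterval lam mu k' m' M') (h1 : m' < m)
    (h2 : m ≤ M') (h3 : M' < M) : False := by
  have h4 := h'.occurs (m - 1) (by omega) (by omega)
  have h5 := h.not_pred
  have h6 := h.occurs (M' + 1) (by omega) (by omega)
  have h7 := h'.not_succ
  unfold OccursAt at *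
  omega

/-! ### Removing a piece of the border strip -/

/-- The shape obtained from `lam` by removing the part of the border strip with contents from
`x + 1` to the last content of row `i`. -/
def removeStrip (lam : YoungDiagram) (i : ℕ) (x : ℤ) (hx : x ∉ Set.range (bead lam.rowLen)) :
    YoungDiagram where
  cells := lam.cells.filter fun p => content p ≤ stripBead (bead lam.rowLen) i x p.1
  isLowerSet := by
    intro p q hqp hp
    -- Strictly decreasing beads are the same as weakly decreasing row lengths.
    have hanti : Antitone fun r : ℕ => stripBead (bead lam.rowLen) i x r + r :=
      antitone_nat_of_succ_le fun r => by
        have := stripBead_strictAnti (bead_rowLen_strictAnti lam) hx i (Nat.lt_succ_self r)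
        simp only [Nat.succ_eq_add_one] at this
        push_cast
        omega
    simp only [Finset.coe_filter, Set.mem_ofPred_eq, YoungDiagram.mem_cells] at hp ⊢
    refine ⟨lam.isLowerSet hqp hp.1, ?_⟩
    have h1 := hanti hqp.1
    have h2 := hqp.2
    have h3 := hp.2
    simp only [content] at h1 h2 h3 ⊢
    omega

lemma mem_removeStrip {lam : YoungDiagram} {i : ℕ} {x : ℤ}
    {hx : x ∉ Set.range (bead lam.rowLen)} {p : ℕ × ℕ} :
    p ∈ removeStrip lam i x hx ↔ content p ≤ stripBead (bead lam.rowLen) i x p.1 := by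
  rw [← YoungDiagram.mem_cells]
  simp only [removeStrip, Finset.mem_filter, YoungDiagram.mem_cells]
  rw [and_iff_right_iff_imp, mem_iff_content_le]
  exact fun h => h.trans (stripBead_le _ _ _ _)

lemma removeStrip_le (lam : YoungDiagram) (i : ℕ) (x : ℤ) (hx : x ∉ Set.range (bead lam.rowLen)) :
    removeStrip lam i x hx ≤ lam := fun _ hp => (Finset.mem_filter.1 hp).1

lemma bead_eq_of_colLen_le {lam : YoungDiagram} {p : ℕ} (hp : lam.colLen 0 ≤ p) :
    bead lam.rowLen p = -p - 1 := by
  simp only [bead, (rowLen_eq_zero_iff lam p).2 hp]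
  omega

/-- Every integer below minus the number of parts is the bead of an empty row. -/
lemma neg_colLen_le_of_notMem {lam : YoungDiagram} {x : ℤ}
    (hx : x ∉ Set.range (bead lam.rowLen)) : -(lam.colLen 0 : ℤ) ≤ x := by
  by_contra hlt
  refine hx ⟨(-x - 1).toNat, ?_⟩
  rw [bead_eq_of_colLen_le (by omega)]
  omega

lemma bead_removeStrip {lam : YoungDiagram} {i : ℕ} {x : ℤ}
    (hx : x ∉ Set.range (bead lam.rowLen)) :
    bead (removeStrip lam i x hx).rowLen = stripBead (bead lam.rowLen) i x := by
  funext r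
  have hge : -(r : ℤ) - 1 ≤ stripBead (bead lam.rowLen) i x r := by
    have h1 := neg_colLen_le_of_notMem hx
    have h2 := rowLen_eq_zero_iff lam r
    have h3 := rowLen_eq_zero_iff lam (r + 1)
    simp only [stripBead, bead]
    split_ifs <;> omega
  have key : ∀ j : ℕ, j < (removeStrip lam i x hx).rowLen r ↔
      (j : ℤ) - r ≤ stripBead (bead lam.rowLen) i x r := fun j => by
    rw [← YoungDiagram.mem_iff_lt_rowLen, mem_removeStrip]
    rfl
  have h1 := key ((stripBead (bead lam.rowLen) i x r + r + 1).toNat)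
  have h2 := key ((stripBead (bead lam.rowLen) i x r + r).toNat)
  simp only [bead] at *
  omega

/-- In a row r ≥ i of `lam`, a removed cell has content above both the next bead, so that its
diagonal neighbour is missing, and x. -/
lemma skewCells_removeStrip {lam : YoungDiagram} {i : ℕ} {x : ℤ}
    (hx : x ∉ Set.range (bead lam.rowLen)) :
    skewCells lam (removeStrip lam i x hx) =
      {p | p ∈ borderStrip lam ∧ x + 1 ≤ content p ∧ content p ≤ bead lam.rowLen i} := by
  ext p
  change p ∈ lam ∧ p ∉ removeStrip lam i x hx ↔ (p ∈ lam ∧ (p.1 + 1, p.2 + 1) ∉ lam) ∧ _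
  rw [mem_removeStrip, mem_iff_content_le, mem_iff_content_le, content_diag, and_assoc]
  refine and_congr_right fun hp => ?_
  have hanti := (bead_rowLen_strictAnti lam).antitone
  unfold stripBead
  split_ifs with hi
  · have := hanti (show p.1 + 1 ≤ i by omega)
    simp only
    omega
  · have := hanti (not_lt.1 hi)
    simp only
    omega

/-! ### Endpoints of the Lascoux–Pragacz strips -/

section

variable {lam mu : YoungDiagram} {n : ℕ} {θ : Fin n → Set (ℕ × ℕ)} {m M : Fin n → ℤ}

lemma exists_isStripInterval (hθ : IsLascouxPragacz lam mu θ)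
    (hm : ∀ i, IsLeast (content '' θ i) (m i)) (hM : ∀ i, IsGreatest (content '' θ i) (M i))
    (s : Fin n) : ∃ k, IsStripInterval lam mu k (m s) (M s) ∧
      θ s = {v | v ∈ shiftedIntersection lam mu k ∧ m s ≤ content v ∧ content v ≤ M s} := by
  obtain ⟨k, p, hp, hC⟩ : θ s ∈ lascouxPragaczStrips lam mu := hθ.2 ▸ Set.mem_range_self s
  have hms := hm s
  have hMs := hM s
  rw [hC] at hms hMs
  obtain ⟨h1, -, -, h2⟩ := isStripInterval_component hp hms hMs
  exact ⟨k, h1, hC.trans h2⟩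

/-- The left end determines the level, and maximal runs that overlap at one level coincide. -/
lemma left_injective (hθ : IsLascouxPragacz lam mu θ)
    (hm : ∀ i, IsLeast (content '' θ i) (m i)) (hM : ∀ i, IsGreatest (content '' θ i) (M i)) :
    Function.Injective m := by
  intro s t hst
  obtain ⟨k, hs, hs'⟩ := exists_isStripInterval hθ hm hM s
  obtain ⟨l, ht, ht'⟩ := exists_isStripInterval hθ hm hM t
  have hkl : k = l := by
    rw [hs.left_mem.2.2, ht.left_mem.2.2, hst]
  subst hkl
  have h1 := hs.le
  have h2 := ht.le
  have : M s = M t :=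
    le_antisymm (hs.right_le_of_overlap ht (by omega)) (ht.right_le_of_overlap hs (by omega))
  refine hθ.1 ?_
  rw [hs', ht', hst, this]

lemma right_injective (hθ : IsLascouxPragacz lam mu θ)
    (hm : ∀ i, IsLeast (content '' θ i) (m i)) (hM : ∀ i, IsGreatest (content '' θ i) (M i)) :
    Function.Injective M := by
  intro s t hst
  obtain ⟨k, hs, hs'⟩ := exists_isStripInterval hθ hm hM s
  obtain ⟨l, ht, ht'⟩ := exists_isStripInterval hθ hm hM t
  have hkl : k = l := by
    rw [hs.right_mem.2.2, ht.right_mem.2.2, hst]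
  subst hkl
  have h1 := hs.le
  have h2 := ht.le
  have : m s = m t :=
    le_antisymm (ht.left_le_of_overlap hs (by omega)) (hs.left_le_of_overlap ht (by omega))
  refine hθ.1 ?_
  rw [hs', ht', hst, this]

/-- Converse to `IsStripInterval.right_mem`: at the level given there, content x occurs and x + 1
does not. -/
lemma exists_right_eq (hmu : mu ≤ lam) (hθ : IsLascouxPragacz lam mu θ)
    (hm : ∀ i, IsLeast (content '' θ i) (m i)) (hM : ∀ i, IsGreatest (content '' θ i) (M i))
    {x : ℤ} (hx : x ∈ Set.range (bead lam.rowLen)) (hx' : x ∉ Set.range (bead mu.rowLen)) :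
    ∃ s, M s = x := by
  have h1 := beadCount_eq_succ hx
  have h2 := beadCount_eq hx'
  -- This inequality says that the chosen level is nonpositive.
  have h3 : beadCount mu (x + 1) ≤ beadCount lam (x + 1) := by
    refine le_of_forall_lt fun i hi => ?_
    rw [lt_beadCount_iff] at hi ⊢
    have := rowLen_mono hmu i
    simp only [bead] at hi ⊢
    omega
  obtain ⟨p, hp, hpx⟩ : ∃ p ∈ shiftedIntersection lam mu (beadCount mu x + 1 - beadCount lam x),
      content p = x := OccursAt.exists_mem ⟨by omega, by omega⟩
  obtain ⟨s, hs⟩ : component (shiftedIntersection lam mu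
      (beadCount mu x + 1 - beadCount lam x)) p ∈ Set.range θ := by
    rw [hθ.2]
    exact ⟨_, p, hp, rfl⟩
  have hms := hm s
  have hMs := hM s
  rw [hs] at hms hMs
  obtain ⟨h4, h5, h6, -⟩ := isStripInterval_component hp hms hMs
  refine ⟨s, ?_⟩
  by_contra hne
  have := (h4.occurs (x + 1) (by omega) (by omega)).2
  omega

lemma substrip_eq (hm : ∀ i, IsLeast (content '' θ i) (m i))
    (hM : ∀ i, IsGreatest (content '' θ i) (M i)) (hsub : ∀ i, θ i ⊆ skewCells lam mu)
    (i j : Fin n) : substrip lam mu (m i) (M j) =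
      {p | p ∈ borderStrip lam ∧ m i ≤ content p ∧ content p ≤ M j} := by
  ext p
  constructor
  · rintro ⟨⟨h1, -⟩, h2⟩
    exact ⟨h1, h2⟩
  · rintro ⟨h1, h2⟩
    obtain ⟨u, hu, hum⟩ := (hm i).1
    obtain ⟨v, hv, hvM⟩ := (hM j).1
    exact ⟨⟨h1, u, hsub i hu, v, hsub j hv, hum.trans_le h2.1, h2.2.trans_eq hvM.symm⟩, h2⟩

end

/-! ### Assembling the determinant and matching the signs -/

/-- The entries of the Lascoux--Pragacz matrix as Jacobi--Trudi determinants. -/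
lemma ootSubstrip_eq {lam mu : YoungDiagram} {i : Fin (lam.colLen 0)} {x : ℤ}
    (hx : x ∉ Set.range (bead lam.rowLen))
    (hs : substrip lam mu (x + 1) (bead lam.rowLen i) =
      {p | p ∈ borderStrip lam ∧ x + 1 ≤ content p ∧ content p ≤ bead lam.rowLen i}) :
    (flagMatrix (lam.colLen 0) (bead lam.rowLen) (replaceBead (bead lam.rowLen) i x)).det =
      (∏ l ∈ Finset.Ioi i, if x < bead lam.rowLen l then -1 else 1) *
        ootSubstrip lam mu (x + 1) (bead lam.rowLen i) := by
  have hne : bead lam.rowLen i ≠ x := fun h => hx ⟨_, h⟩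
  unfold ootSubstrip
  split_ifs with h
  · rw [ootOfCells_eq (removeStrip_le lam i x hx) ((skewCells_removeStrip hx).trans hs.symm),
      oot_eq_det (removeStrip_le lam i x hx), bead_removeStrip hx]
    refine det_replaceBead (bead_rowLen_strictAnti lam) (fun p hp => ?_) hx (by omega)
    rw [bead_eq_of_colLen_le hp, bead_eq_of_colLen_le (by omega)]
    push_cast
    ring
  · rw [mul_zero]
    exact det_replaceBead_eq_zero (bead_rowLen_strictAnti lam) (by omega)

/-- The Lascoux--Pragacz determinant for Okounkov--Olshanski tableaux. -/
theorem oot_eq_det_ootSubstrip {lam mu : YoungDiagram} (hmu : mu ≤ lam) {n : ℕ}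
    {θ : Fin n → Set (ℕ × ℕ)} (hθ : IsLascouxPragacz lam mu θ) {m M : Fin n → ℤ}
    (hm : ∀ i, IsLeast (content '' θ i) (m i)) (hM : ∀ i, IsGreatest (content '' θ i) (M i))
    (hsub : ∀ i, θ i ⊆ skewCells lam mu) :
    (oot lam mu : ℤ) = (Matrix.of fun i j : Fin n => ootSubstrip lam mu (m i) (M j)).det := by
  classical
  set d := lam.colLen 0 with hd
  set a := bead lam.rowLen with ha_def
  set b := bead mu.rowLen with hb_def
  have ha : StrictAnti a := bead_rowLen_strictAnti lam
  have hb : StrictAnti b := bead_rowLen_strictAnti mu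
  have hab : ∀ i, d ≤ i → a i = b i := fun i hi => by
    by_contra hne
    exact absurd (lt_colLen_of_bead_ne hmu i hne) (not_lt.2 hi)
  choose k hk _ using exists_isStripInterval hθ hm hM
  have hidx : ∀ s, ∃ i : Fin d, a i = M s := fun s => by
    obtain ⟨⟨i, hi⟩, h2, -⟩ := (hk s).right_mem
    refine ⟨⟨i, ?_⟩, hi⟩
    by_contra hcon
    exact h2 ⟨i, (hab i (not_lt.1 hcon)).symm.trans hi⟩
  choose idx hidx using hidx
  have hidx_inj : Function.Injective idx := fun s t h =>
    right_injective hθ hm hM (by rw [← hidx, ← hidx, h])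
  -- The beads of `mu` in the order dictated by the strips: m s - 1 takes the place of M s, and the
  -- common beads stay where they are in `a`.
  let β : Fin d → ℤ := fun i =>
    if h : ∃ s, idx s = i then m h.choose - 1 else a i
  have hβ_idx : ∀ s, β (idx s) = m s - 1 := fun s => by
    have h : ∃ t, idx t = idx s := ⟨s, rfl⟩
    simp only [β, dif_pos h, hidx_inj h.choose_spec]
  have hβ_other : ∀ i, i ∉ Set.range idx → β i = a i := fun i hi => dif_neg hi
  have hβ_b : ∀ i, ∃ j : Fin d, β i = b j := fun i => by
    by_cases hi : i ∈ Set.range idx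
    · obtain ⟨s, rfl⟩ := hi
      obtain ⟨h1, ⟨j, hj⟩, -⟩ := (hk s).left_mem
      refine ⟨⟨j, ?_⟩, (hβ_idx s).trans hj.symm⟩
      by_contra hcon
      exact h1 ⟨j, (hab j (not_lt.1 hcon)).trans hj⟩
    · rw [hβ_other i hi]
      have h1 : a i ∈ Set.range b := by
        by_contra hcon
        obtain ⟨s, hs⟩ := exists_right_eq hmu hθ hm hM ⟨i, rfl⟩ hcon
        exact hi ⟨s, Fin.ext (ha.injective ((hidx s).trans hs))⟩
      obtain ⟨j, hj⟩ := h1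
      refine ⟨⟨j, ?_⟩, hj.symm⟩
      by_contra hcon
      have h2 : a j = a i := (hab j (not_lt.1 hcon)).trans hj
      have := ha.injective h2
      omega
  have hβ_le : ∀ i, β i ≤ a i := fun i => by
    by_cases hi : i ∈ Set.range idx
    · obtain ⟨s, rfl⟩ := hi
      have := (hk s).le
      rw [hβ_idx, hidx]
      omega
    · rw [hβ_other i hi]
  have hβ_idx_ne : ∀ s i, i ∉ Set.range idx → β (idx s) ≠ β i := fun s i hi h => by
    rw [hβ_idx, hβ_other i hi] at h
    exact (hk s).left_mem.1 ⟨i, h.symm⟩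
  have hβ_inj : Function.Injective β := fun i j h => by
    by_cases hi : i ∈ Set.range idx <;> by_cases hj : j ∈ Set.range idx
    · obtain ⟨s, rfl⟩ := hi
      obtain ⟨t, rfl⟩ := hj
      rw [hβ_idx, hβ_idx] at h
      rw [left_injective hθ hm hM (show m s = m t by omega)]
    · obtain ⟨s, rfl⟩ := hi
      exact absurd h (hβ_idx_ne s j hj)
    · obtain ⟨t, rfl⟩ := hj
      exact absurd h.symm (hβ_idx_ne t i hi)
    · rw [hβ_other i hi, hβ_other j hj] at h
      exact Fin.ext (ha.injective h)
  -- The two comparisons could differ only if β j < β i < a j < a i, which would mean two crossing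
  -- strips.
  have hcross : ∀ i j : Fin d, i < j → (β i < β j ↔ β i < a j) := fun i j hij => by
    refine ⟨fun h => h.trans_le (hβ_le j), fun h => ?_⟩
    by_contra hcon
    have h1 : β j < β i := lt_of_le_of_ne (not_lt.1 hcon) fun h => hij.ne (hβ_inj h.symm)
    have h2 : a j < a i := ha (Fin.lt_def.1 hij)
    have hi : i ∈ Set.range idx := by
      by_contra hi
      rw [hβ_other i hi] at h
      omega
    have hj : j ∈ Set.range idx := by
      by_contra hj
      rw [hβ_other j hj] at h1
      omega
    obtain ⟨s, rfl⟩ := hi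
    obtain ⟨t, rfl⟩ := hj
    rw [hidx, hidx] at h2
    rw [hβ_idx, hβ_idx] at h1
    rw [hβ_idx, hidx] at h
    exact (hk s).not_cross (hk t) (by omega) (by omega) h2
  have hentry : ∀ s t, (flagMatrix d a (replaceBead a (idx t) (β (idx s)))).det =
      (∏ l ∈ Finset.Ioi (idx t), if β (idx s) < a l then -1 else 1) *
        ootSubstrip lam mu (m s) (M t) := fun s t => by
    have h1 := (hk s).left_mem.1
    have h2 := ootSubstrip_eq (mu := mu) (i := idx t) h1 (by
      rw [sub_add_cancel, ← ha_def, hidx]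
      exact substrip_eq hm hM hsub s t)
    rw [sub_add_cancel, ← ha_def, hidx] at h2
    rw [hβ_idx]
    exact h2
  let ε : Fin n → ℤ := fun s => ∏ l : Fin d, if β (idx s) < a l then (-1 : ℤ) else 1
  let δ : Fin n → ℤ := fun t => (-1) ^ ((idx t : ℕ) + 1)
  -- The sign factorization requires m s ≤ M t; otherwise both sides are zero.
  have hentry' : ∀ s t, (flagMatrix d a (replaceBead a (idx t) (β (idx s)))).det =
      ε s * (δ t * ootSubstrip lam mu (m s) (M t)) := fun s t => by
    rw [hentry]
    by_cases h : m s ≤ M t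
    · rw [prod_Ioi_sign ha (by rw [hβ_idx, hidx]; omega), mul_assoc]
    · simp [ootSubstrip, h]
  have hsign : (∏ i, ∏ j ∈ Finset.Ioi i, if β i < β j then (-1 : ℤ) else 1) =
      (∏ s, ε s) * ∏ s, δ s := by
    rw [← Finset.prod_mul_distrib]
    have h1 : ∀ i, (∏ j ∈ Finset.Ioi i, if β i < β j then (-1 : ℤ) else 1) =
        ∏ j ∈ Finset.Ioi i, if β i < a j then (-1 : ℤ) else 1 := fun i =>
      Finset.prod_congr rfl fun j hj => if_congr (hcross i j (Finset.mem_Ioi.1 hj)) rfl rfl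
    rw [Finset.prod_congr rfl fun i _ => h1 i,
      ← Finset.prod_subset (Finset.subset_univ (Finset.univ.image idx)),
      Finset.prod_image fun s _ t _ h => hidx_inj h]
    · refine Finset.prod_congr rfl fun s _ => ?_
      have := (hk s).le
      exact prod_Ioi_sign ha (by rw [hβ_idx, hidx]; omega)
    · intro i _ hi
      refine Finset.prod_eq_one fun j hj => if_neg ?_
      rw [hβ_other i (by simpa using hi)]
      exact (ha (Fin.lt_def.1 (Finset.mem_Ioi.1 hj))).not_gt
  have hne : (∏ i, ∏ j ∈ Finset.Ioi i, if β i < β j then (-1 : ℤ) else 1) ≠ 0 :=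
    Finset.prod_ne_zero_iff.2 fun i _ => Finset.prod_ne_zero_iff.2 fun j _ => by
      split_ifs <;> norm_num
  refine mul_left_cancel₀ hne ?_
  rw [oot_eq_det hmu, ← det_flagMatrix_sort a hb hβ_inj hβ_b,
    det_flagMatrix_eq_det_replaceBead ha hidx_inj hβ_other, hsign, mul_assoc,
    ← Matrix.det_mul_row, ← Matrix.det_mul_column]
  congr 1
  ext s t
  exact hentry' s t

end OkounkovOlshanski

/-- For the Lascoux--Pragacz decomposition `θ` of `lam/mu`, where the contents of `θ i` range from
`m i` to `M i`, the strip `θ i # θ j` is the substrip with contents from `m i` to `M j`. Whenever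
it is defined, it is the diagram of a skew shape `lam/ν` and its `OOT` does not depend on the skew
shape that represents it; and `OOT(lam/mu) = det [OOT(θ i # θ j)]`. -/
theorem mainTheorem7 (lam mu : YoungDiagram) (hmu : mu ≤ lam) (n : ℕ)
    (θ : Fin n → Set (ℕ × ℕ)) (hθ : OkounkovOlshanski.IsLascouxPragacz lam mu θ)
    (m M : Fin n → ℤ)
    (hm : ∀ i, IsLeast (OkounkovOlshanski.content '' θ i) (m i))
    (hM : ∀ i, IsGreatest (OkounkovOlshanski.content '' θ i) (M i)) :
    (∀ i j, m i ≤ M j →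
      (∃ ν : YoungDiagram, ν ≤ lam ∧
        OkounkovOlshanski.skewCells lam ν = OkounkovOlshanski.substrip lam mu (m i) (M j)) ∧
      (∀ α β : YoungDiagram, β ≤ α →
        OkounkovOlshanski.skewCells α β = OkounkovOlshanski.substrip lam mu (m i) (M j) →
        OkounkovOlshanski.ootOfCells (OkounkovOlshanski.substrip lam mu (m i) (M j)) =
          OkounkovOlshanski.oot α β)) ∧
    (OkounkovOlshanski.oot lam mu : ℤ) =
      Matrix.det (Matrix.of fun i j : Fin n =>
        OkounkovOlshanski.ootSubstrip lam mu (m i) (M j)) := by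
  have hsub : ∀ i, θ i ⊆ OkounkovOlshanski.skewCells lam mu := fun i v hv => by
    obtain ⟨k, -, h⟩ := OkounkovOlshanski.exists_isStripInterval hθ hm hM i
    rw [h] at hv
    exact hv.1.1
  refine ⟨fun i j _ => ⟨?_, fun α β h hs => OkounkovOlshanski.ootOfCells_eq h hs⟩,
    OkounkovOlshanski.oot_eq_det_ootSubstrip hmu hθ hm hM hsub⟩
  obtain ⟨k, hk, -⟩ := OkounkovOlshanski.exists_isStripInterval hθ hm hM i
  obtain ⟨l, hl, -⟩ := OkounkovOlshanski.exists_isStripInterval hθ hm hM j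
  obtain ⟨r, hr⟩ := hl.right_mem.1
  refine ⟨_, OkounkovOlshanski.removeStrip_le lam r (m i - 1) hk.left_mem.1, ?_⟩
  rw [OkounkovOlshanski.skewCells_removeStrip, OkounkovOlshanski.substrip_eq hm hM hsub, hr,
    sub_add_cancel]
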